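/- Let $r\ge 2$ and consider type $\mathrm B_r$ with simple roots $\alpha_1,\dots,\alpha_r$ and the invariant form with $(\alpha_i,\alpha_i)=4$ for $i<r$, $(\alpha_r,\alpha_r)=2$, $(\alpha_i,\alpha_{i+1})=-2$ and $(\alpha_i,\alpha_j)=0$ for $|i-j|\ge 2$. Let $\lambda$ be a dominant integral weight with labels $\lambda_i=\langle\lambda,\alpha_i^\vee\rangle\in\mathbb Z_{\ge 0}$, and let $\omega_1$ be the first fundamental weight. For $0\le l\le 2r$ let $\boldsymbol l=(l_1,\dots,l_r)$ be the tuple $(1,\dots,1,0,\dots,0)$ with $l$ ones if $l\le r$, and $(1,\dots,1,2,\dots,2)$ with $2r-l$ ones if $l>r$. The number $l$ is called admissible if $l=0$, or $1\le l\le r$ and $\lambda_l>0$, or $l=r+1$ and $\lambda_r>1$, or $r+1<l\le 2r$ and $\lambda_{2r-l+1}>0$ (these are the $l$ for which $V_{\lambda+\omega_1-\sum_i l_i\alpha_i}$ occurs in $V_\lambda\otimes V_{\omega_1}$). The Bethe ansatz equation associated to $\boldsymbol\Lambda=(\lambda,\omega_1)$, $\boldsymbol z=(0,1)$ and $\boldsymbol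 l$ is the following system for $t_1,\dots,t_l\in\mathbb C$, in which $l_i$ of the variables have colour $i$ and $c(p)$ denotes the colour of $t_p$: $$-\frac{(\alpha_{c(p)},\lambda)}{t_p}-\frac{(\alpha_{c(p)},\omega_1)}{t_p-1}+\sum_{q\ne p}\frac{(\alpha_{c(p)},\alpha_{c(q)})}{t_p-t_q}=0,\qquad p=1,\dots,l,$$ where in a solution every term with non-zero numerator must have non-zero denominator, and terms with zero numerator are omitted. Solutions that differ by a permutation of variables of the same colour are identified. A solution is represented by the polynomials $y_i(x)=\prod_{c(p)=i}(x-t_p)$, $i=1,\dots,r$. Then for every admissible $l$ the Bethe ansatz equation has exactly one solution, and for every $l\in\{0,\dots,2r\}$ that is not admissible it has none. For admissible $l$ the solution is given as follows. If $l\le r$, then $y_j=x-c_j$ for $j\le l$ and $y_j=1$ for $j>l$, where, if $l<r$, $$c_j=\prod_{i=1}^j\frac{\lambda_i+\dots+\lambda_l+l-i}{\lambda_i+\dots+\lambda_l+l-i+1},$$ and, if $l=r$, $$c_j=\prod_{i=1}^j\frac{\lambda_i+\dots+\lambda_{r-1}+\lambda_r/2+r-i}{\lambda_i+\dots+\lambda_{r-1}+\lambda_r/2+r-i+1}.$$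 If $l\ge r+1$, put $m=2r-l$ and $S_{a,j}=\lambda_a+\dots+\lambda_j+2\lambda_{j+1}+\dots+2\lambda_{r-1}+\lambda_r$. Then $y_k=x-c_k$ for $1\le k\le m$ and $y_k=x^2-(a_k+b_k)x+a_kb_k=(x-a_k)(x-b_k)$ for $m+1\le k\le r$, where $$c_k=\prod_{j=1}^k\frac{S_{j,m}+l-j-1}{S_{j,m}+l-j},$$ $$a_kb_k=\Big(\prod_{j=1}^{m}\frac{S_{j,m}+l-j-1}{S_{j,m}+l-j}\Big)^2\,G_{r-1}\,G_{k-1}\,H_k\;\frac{2\lambda_{m+1}+\dots+2\lambda_{r-1}+\lambda_r+2l-2r-3}{2\lambda_{m+1}+\dots+2\lambda_{r-1}+\lambda_r+2l-2r-1},$$ $$a_k+b_k=\frac{2\lambda_{m+1}+\dots+2\lambda_{r-1}+\lambda_r+2l-2r-3}{2\lambda_{m+1}+\dots+2\lambda_{r-1}+\lambda_r+2l-2r-2}\Big(\prod_{j=1}^{m}\frac{S_{j,m}+l-j-1}{S_{j,m}+l-j}\Big)\big(G_{k-1}+G_{r-1}H_k\big),$$ $$G_b=\prod_{j=m+1}^{b}\frac{S_{m+1,j}+l-j-2}{S_{m+1,j}+l-j-1},\qquad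 H_k=\prod_{i=1}^{r-k}\frac{\lambda_{m+1}+\dots+\lambda_{r-i}+l-r-i-1}{\lambda_{m+1}+\dots+\lambda_{r-i}+l-r-i}.$$ Empty sums are $0$ and empty products are $1$. -/

import Mathlib

open scoped BigOperators Polynomial

namespace BetheB

/-! ### The Bethe ansatz equation

A simple Lie algebra enters through its Cartan matrix `A`, with entries `a i j = ⟨α_j, α_i^∨⟩`, and
the symmetrizing integers `d i`; the invariant form is normalized by `(α_i, α_j) = d i * a i j`.
A weight `Λ` is given by its labels `Λ i = ⟨Λ, α_i^∨⟩`, so that `(α_i, Λ) = d i * Λ i`.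
The variables of colour `i` are the `t ⟨i, k⟩` with `k : Fin (l i)`. -/

/-- `(α_i, α_j)` -/
def rootRoot {ι : Type*} (A : Matrix ι ι ℤ) (d : ι → ℕ) (i j : ι) : ℂ := (d i : ℂ) * (A i j : ℂ)

/-- `(α_i, Λ)` -/
def rootWeight {ι : Type*} (d : ι → ℕ) (i : ι) (Λ : ι → ℂ) : ℂ := (d i : ℂ) * Λ i

/-- `t` solves the Bethe ansatz equation associated to `Λ`, `z`, `l`. The first two clauses say that
every term with a non-zero numerator has a non-zero denominator; the terms with numerator zero
contribute zero. -/
def IsCriticalPoint {ι : Type*} [Fintype ι] [DecidableEq ι] (A : Matrix ι ι ℤ) (d : ι → ℕ)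
    {n : ℕ} (Λ : Fin n → ι → ℂ) (z : Fin n → ℂ) (l : ι → ℕ)
    (t : (Σ i : ι, Fin (l i)) → ℂ) : Prop :=
  (∀ p s, rootWeight d p.1 (Λ s) ≠ 0 → t p ≠ z s) ∧
  (∀ p q, p ≠ q → rootRoot A d p.1 q.1 ≠ 0 → t p ≠ t q) ∧
  ∀ p, -(∑ s, rootWeight d p.1 (Λ s) / (t p - z s)) +
      ∑ q ∈ Finset.univ.erase p, rootRoot A d p.1 q.1 / (t p - t q) = 0

/-- `t` and `t'` differ by a permutation of the variables that preserves the colours. -/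
def SameOrbit {ι : Type*} {l : ι → ℕ} (t t' : (Σ i : ι, Fin (l i)) → ℂ) : Prop :=
  ∃ σ : (i : ι) → Equiv.Perm (Fin (l i)), ∀ i k, t' ⟨i, k⟩ = t ⟨i, σ i k⟩

/-- The polynomials `y_i(x) = ∏ (x - t_j)`, over the variables `t_j` of colour `i`. -/
noncomputable def polyTuple {ι : Type*} {l : ι → ℕ} (t : (Σ i : ι, Fin (l i)) → ℂ) (i : ι) :
    ℂ[X] :=
  ∏ k : Fin (l i), (Polynomial.X - Polynomial.C (t ⟨i, k⟩))

/-! ### Type `B_r`, weights `(lam, ω_1)`, points `(0, 1)` -/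

/-- The matrix `⟨α_j, α_i^∨⟩` of type `B_r`, where `α_r` is the short simple root.
(Mathlib's `CartanMatrix.B` has the entry `⟨α_i, α_j^∨⟩` in place `i j`.) -/
def cartanB (r : ℕ) : Matrix (Fin r) (Fin r) ℤ := (CartanMatrix.B r).transpose

/-- The integers `d i = (α_i, α_i) / 2`: `2` for `i < r` and `1` for `i = r`. -/
def symmB (r : ℕ) (i : Fin r) : ℕ := if (i : ℕ) + 1 = r then 1 else 2

/-- The labels of the pair of weights `(lam, ω_1)`. -/
def weightsB {r : ℕ} (lam : Fin r → ℕ) : Fin 2 → Fin r → ℂ :=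
  ![fun i => (lam i : ℂ), fun i => if (i : ℕ) = 0 then 1 else 0]

/-- The `r`-tuple of length `L ≤ 2 * r`: it is `(1, …, 1, 0, …, 0)` with `L` ones if `L ≤ r`, and
`(1, …, 1, 2, …, 2)` with `2 * r - L` ones if `r < L`. -/
def lengthTuple (r L : ℕ) (i : Fin r) : ℕ :=
  if L ≤ r then (if (i : ℕ) + 1 ≤ L then 1 else 0)
  else (if (i : ℕ) + 1 ≤ 2 * r - L then 1 else 2)

/-- `t` solves the Bethe ansatz equation of type `B_r` associated to `(lam, ω_1)`, `(0, 1)` and the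
tuple of length `L`. -/
def IsSolutionB {r : ℕ} (lam : Fin r → ℕ) (L : ℕ)
    (t : (Σ i : Fin r, Fin (lengthTuple r L i)) → ℂ) : Prop :=
  IsCriticalPoint (cartanB r) (symmB r) (weightsB lam) ![0, 1] (lengthTuple r L) t

/-- `lam_m` in the numbering `m = 1, …, r`. -/
def label {r : ℕ} (lam : Fin r → ℕ) (m : ℕ) : ℕ :=
  if h : 1 ≤ m ∧ m ≤ r then lam ⟨m - 1, by omega⟩ else 0

/-- Admissible lengths: `L = 0`, or `1 ≤ L ≤ r` and `lam_L > 0`, or `L = r + 1` and `lam_r > 1`, or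
`r + 1 < L ≤ 2 r` and `lam_{2r-L+1} > 0`. -/
def Admissible {r : ℕ} (lam : Fin r → ℕ) (L : ℕ) : Prop :=
  L = 0 ∨ (1 ≤ L ∧ L ≤ r ∧ 0 < label lam L) ∨ (L = r + 1 ∧ 1 < label lam r) ∨
    (r + 1 < L ∧ L ≤ 2 * r ∧ 0 < label lam (2 * r - L + 1))

/-- `lam_a + ⋯ + lam_b` -/
noncomputable def sumLabels {r : ℕ} (lam : Fin r → ℕ) (a b : ℕ) : ℂ :=
  ∑ m ∈ Finset.Icc a b, (label lam m : ℂ)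

/-- `lam_a + ⋯ + lam_j + 2 lam_{j+1} + ⋯ + 2 lam_{r-1} + lam_r`, for `j < r` -/
noncomputable def foldedSum {r : ℕ} (lam : Fin r → ℕ) (a j : ℕ) : ℂ :=
  sumLabels lam a j + 2 * sumLabels lam (j + 1) (r - 1) + (label lam r : ℂ)

/-- `c_j^{(L)}` for `L < r` -/
noncomputable def rootLow {r : ℕ} (lam : Fin r → ℕ) (L j : ℕ) : ℂ :=
  ∏ i ∈ Finset.Icc 1 j,
    (sumLabels lam i L + L - i) / (sumLabels lam i L + L - i + 1)

/-- `c_j^{(r)}` -/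
noncomputable def rootMid {r : ℕ} (lam : Fin r → ℕ) (j : ℕ) : ℂ :=
  ∏ i ∈ Finset.Icc 1 j,
    (sumLabels lam i (r - 1) + (label lam r : ℂ) / 2 + r - i) /
      (sumLabels lam i (r - 1) + (label lam r : ℂ) / 2 + r - i + 1)

/-- `c_k^{(L)}` for `L > r` -/
noncomputable def rootHigh {r : ℕ} (lam : Fin r → ℕ) (L k : ℕ) : ℂ :=
  ∏ j ∈ Finset.Icc 1 k,
    (foldedSum lam j (2 * r - L) + L - j - 1) / (foldedSum lam j (2 * r - L) + L - j)

/-- The product over `2 r - L + 1 ≤ j < b` of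
`(S_j + L - j - 2) / (S_j + L - j - 1)`, with
`S_j = lam_{2r-L+1} + ⋯ + lam_j + 2 lam_{j+1} + ⋯ + 2 lam_{r-1} + lam_r`. -/
noncomputable def factorG {r : ℕ} (lam : Fin r → ℕ) (L b : ℕ) : ℂ :=
  ∏ j ∈ Finset.Ico (2 * r - L + 1) b,
    (foldedSum lam (2 * r - L + 1) j + L - j - 2) /
      (foldedSum lam (2 * r - L + 1) j + L - j - 1)

/-- The product over `1 ≤ i ≤ r - k` of
`(lam_{2r-L+1} + ⋯ + lam_{r-i} + L - r - i - 1) / (lam_{2r-L+1} + ⋯ + lam_{r-i} + L - r - i)`. -/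
noncomputable def factorH {r : ℕ} (lam : Fin r → ℕ) (L k : ℕ) : ℂ :=
  ∏ i ∈ Finset.Icc 1 (r - k),
    (sumLabels lam (2 * r - L + 1) (r - i) + L - r - i - 1) /
      (sumLabels lam (2 * r - L + 1) (r - i) + L - r - i)

/-- `2 lam_{2r-L+1} + ⋯ + 2 lam_{r-1} + lam_r + 2 L - 2 r` -/
noncomputable def topSum {r : ℕ} (lam : Fin r → ℕ) (L : ℕ) : ℂ :=
  2 * sumLabels lam (2 * r - L + 1) (r - 1) + (label lam r : ℂ) + 2 * L - 2 * r

/-- `a_k^{(L)} b_k^{(L)}` for `L > r` and `2 r - L < k ≤ r` -/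
noncomputable def rootProd {r : ℕ} (lam : Fin r → ℕ) (L k : ℕ) : ℂ :=
  rootHigh lam L (2 * r - L) ^ 2 * factorG lam L r * factorG lam L k * factorH lam L k *
    ((topSum lam L - 3) / (topSum lam L - 1))

/-- `a_k^{(L)} + b_k^{(L)}` for `L > r` and `2 r - L < k ≤ r` -/
noncomputable def rootSum {r : ℕ} (lam : Fin r → ℕ) (L k : ℕ) : ℂ :=
  (topSum lam L - 3) / (topSum lam L - 2) * rootHigh lam L (2 * r - L) *
    (factorG lam L k + factorG lam L r * factorH lam L k)

/-- The `k`-th polynomial (`1 ≤ k ≤ r`) of the explicit `r`-tuple of length `L`. -/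
noncomputable def explicitPoly {r : ℕ} (lam : Fin r → ℕ) (L k : ℕ) : ℂ[X] :=
  if L ≤ r then
    if k ≤ L then
      Polynomial.X - Polynomial.C (if L < r then rootLow lam L k else rootMid lam k)
    else 1
  else if k ≤ 2 * r - L then Polynomial.X - Polynomial.C (rootHigh lam L k)
  else Polynomial.X ^ 2 - Polynomial.C (rootSum lam L k) * Polynomial.X +
    Polynomial.C (rootProd lam L k)

end BetheB

/-! If `L ≤ r`, each colour in use has one variable. Eliminating from the top colour down, colour
`k` satisfies `W k / c k + 1 / (c k - c (k - 1)) = 0`, where `W k` accumulates the labels from `k`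
on. Starting from the point `c 0 = 1`, each variable is thus forced by the previous one
(`chain_iff`).

If `L > r`, colours beyond `m = 2r - L` carry pairs, which are removed by reflection. When `y = (x -
a)(x - b)` solves the equations of a colour with label `μ`, left neighbour `u` and right neighbours
`v, z`, some `ŷ = x - h` has Wronskian `W(y, x^(μ+1) ŷ) = μ x^μ (x - u)(x - v)(x - z)`
(`exists_reflects`). Trading `y` for `ŷ` leaves a shorter tail with left neighbour `h` and first
label raised by `μ + 1`, as in the shifted action of a simple reflection (`Tail.exists_step`).
Summing all equations of the tail times their variables yields a constant `M` that reflections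
preserve. It determines `h`, and it shows that the tail acts on the last single variable like an
extra label `M + 1`, so the single variables form a chain again. The last pair is solved directly
(`Tail.zero_iff`), and undoing the reflections gives all sums and products (`TailData.closed_form`).

Existence runs the same steps backwards. It needs the roots of each quadratic to be distinct
(`TailData.discr_ne_zero`). Inadmissible lengths fail because a zero label is impossible, and for `L
= r + 1` the label `1` forces a zero root. Uniqueness holds since the polynomials determine the
variables up to permutation. -/

namespace BetheB

/-! ### Chains of single variables. -/

/-- Closed form of a chain of single variables, each coupled to its neighbours. -/
theorem chain_iff {n : ℕ} {w W c : ℕ → ℂ} (h0 : c 0 = 1) (hWn : W n = w n)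
    (hW : ∀ k, 1 ≤ k → k < n → W k = w k + W (k + 1) + 1)
    (hne : ∀ k, 1 ≤ k → k ≤ n → W k ≠ 0) (hne' : ∀ k, 1 ≤ k → k ≤ n → W k + 1 ≠ 0) :
    (∀ k, 1 ≤ k → k ≤ n → (w k ≠ 0 → c k ≠ 0) ∧ c k ≠ c (k - 1) ∧
      w k / c k + 1 / (c k - c (k - 1)) + (if k < n then 1 / (c k - c (k + 1)) else 0) = 0) ↔
    ∀ k, 1 ≤ k → k ≤ n → c k = c (k - 1) * (W k / (W k + 1)) := by
  constructor
  · intro h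
    -- Descending induction: the equation of `k + 1` makes the interaction of `c k` with `c (k + 1)`
    -- equal to `(W (k + 1) + 1) / c k`, which merges with the label of `k` into `W k`.
    have key : ∀ k, k ≤ n → 1 ≤ k →
        c k ≠ 0 ∧ W k / c k + 1 / (c k - c (k - 1)) = 0 := by
      intro k hk
      induction hk using Nat.decreasingInduction with
      | self =>
        intro hn
        obtain ⟨h1, -, h3⟩ := h n hn le_rfl
        rw [← hWn] at h1 h3
        exact ⟨h1 (hne n hn le_rfl), by simpa using h3⟩
      | of_succ k hk ih =>
        intro h1k
        obtain ⟨i1, i2⟩ := ih (by omega)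
        obtain ⟨-, g2, g3⟩ := h k h1k hk.le
        have g4 := (h (k + 1) (by omega) hk).2.1
        have e1 := hne (k + 1) (by omega) hk
        have e2 := hne' (k + 1) (by omega) hk
        simp only [Nat.add_sub_cancel] at i2 g4
        have g5 : c (k + 1) - c k ≠ 0 := sub_ne_zero.2 g4
        have i3 : c (k + 1) * (W (k + 1) + 1) = W (k + 1) * c k := by
          field_simp at i2
          linear_combination i2
        have ck : c k ≠ 0 := by
          rintro h0
          rw [h0, mul_zero] at i3
          exact (mul_ne_zero i1 e2) i3
        refine ⟨ck, ?_⟩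
        rw [if_pos hk] at g3
        have g6 : c k - c (k + 1) ≠ 0 := sub_ne_zero.2 g4.symm
        have : 1 / (c k - c (k + 1)) = (W (k + 1) + 1) / c k := by
          rw [div_eq_div_iff g6 ck]
          linear_combination i3
        rw [this] at g3
        rw [hW k h1k hk, ← g3]
        ring
    intro k h1 h2
    obtain ⟨g1, g2⟩ := key k h2 h1
    have g3 : c k - c (k - 1) ≠ 0 := sub_ne_zero.2 (h k h1 h2).2.1
    have := hne' k h1 h2
    field_simp at g2 ⊢
    linear_combination g2
  · intro h
    have hc : ∀ k, k ≤ n → c k ≠ 0 := by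
      intro k
      induction k with
      | zero => simp [h0]
      | succ k ih =>
        intro hk
        rw [h (k + 1) (by omega) hk]
        exact mul_ne_zero (ih (by omega))
          (div_ne_zero (hne _ (by omega) hk) (hne' _ (by omega) hk))
    have hsub : ∀ k, 1 ≤ k → k ≤ n → c k - c (k - 1) = - (c k / W k) := by
      intro k h1 h2
      have := hne k h1 h2
      have e := hne' k h1 h2
      have := h k h1 h2
      field_simp at this ⊢
      linear_combination this
    have hd : ∀ k, 1 ≤ k → k ≤ n → c k ≠ c (k - 1) := by
      intro k h1 h2
      rw [← sub_ne_zero, hsub k h1 h2]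
      exact neg_ne_zero.2 (div_ne_zero (hc k h2) (hne k h1 h2))
    intro k h1 h2
    refine ⟨fun _ => hc k h2, hd k h1 h2, ?_⟩
    have ck := hc k h2
    have Wk := hne k h1 h2
    rw [hsub k h1 h2]
    split_ifs with hk
    · have := hsub (k + 1) (by omega) hk
      have e1 := hne (k + 1) (by omega) hk
      have e2 := hne' (k + 1) (by omega) hk
      have e3 := h (k + 1) (by omega) hk
      simp only [Nat.add_sub_cancel] at this e3
      have : c k - c (k + 1) = c k / (W (k + 1) + 1) := by
        rw [e3]; field_simp; ring
      rw [this, hW k h1 hk] at *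
      field_simp
      ring
    · have : k = n := by omega
      subst this
      rw [hWn] at *
      field_simp
      ring

/-! ### Reflection of a pair. -/

/-- The identity `μ (x - u)(x - v)(x - z) = (μ + 1) y ŷ + x (y ŷ' - y' ŷ)` for `y = (x - a)(x - b)`
and `ŷ = x - h`, which expresses that `ŷ` is the reflection of `y`. -/
def Reflects (μ u v z a b h : ℂ) : Prop :=
  ∀ x : ℂ, μ * ((x - u) * (x - v) * (x - z)) =
    (μ + 1) * ((x - a) * (x - b) * (x - h)) +
      x * ((x - a) * (x - b) - (2 * x - a - b) * (x - h))

/-- Both sides of the identity are cubics with leading coefficient `μ`, so their difference is `c2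
x² + c1 x + c0`. The equation at `a` gives it a double root there, and the equation at `b` then
kills `c2`. -/
theorem exists_reflects {μ u v z a b : ℂ} (hμ : μ ≠ 0) (ha : a ≠ 0) (hb : b ≠ 0) (hab : a ≠ b)
    (hau : a ≠ u) (hav : a ≠ v) (haz : a ≠ z) (hbu : b ≠ u) (hbv : b ≠ v) (hbz : b ≠ z)
    (ea : μ / a + 1 / (a - u) + (1 / (a - v) + 1 / (a - z)) - 2 / (a - b) = 0)
    (eb : μ / b + 1 / (b - u) + (1 / (b - v) + 1 / (b - z)) - 2 / (b - a) = 0) :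
    ∃ h, Reflects μ u v z a b h := by
  have hab' := sub_ne_zero.2 hab
  have hba' := sub_ne_zero.2 hab.symm
  have hau' := sub_ne_zero.2 hau
  have hav' := sub_ne_zero.2 hav
  have haz' := sub_ne_zero.2 haz
  have hbu' := sub_ne_zero.2 hbu
  have hbv' := sub_ne_zero.2 hbv
  have hbz' := sub_ne_zero.2 hbz
  -- This `h` makes the two sides agree at `x = a`.
  obtain ⟨h, hh⟩ : ∃ h, μ * ((a - u) * (a - v) * (a - z)) = - (a * (a - b) * (a - h)) :=
    ⟨a + μ * ((a - u) * (a - v) * (a - z)) / (a * (a - b)), by field_simp; ring⟩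
  have ea' : (μ * (a - b) - 2 * a) * ((a - u) * (a - v) * (a - z)) + a * (a - b) *
      ((a - v) * (a - z) + (a - u) * (a - z) + (a - u) * (a - v)) = 0 := by
    field_simp at ea
    linear_combination ea
  have eb' : (μ * (b - a) - 2 * b) * ((b - u) * (b - v) * (b - z)) + b * (b - a) *
      ((b - v) * (b - z) + (b - u) * (b - z) + (b - u) * (b - v)) = 0 := by
    field_simp at eb
    linear_combination eb
  obtain ⟨c2, h2⟩ : ∃ c, c = -μ * (u + v + z) + (μ + 1) * (a + b) + (μ - 1) * h := ⟨_, rfl⟩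
  obtain ⟨c1, h1⟩ : ∃ c, c = μ * (u * v + u * z + v * z) -
    ((μ + 2) * (a * b) + μ * (a + b) * h) := ⟨_, rfl⟩
  obtain ⟨c0, h0⟩ : ∃ c, c = - μ * (u * v * z) + (μ + 1) * (a * b * h) := ⟨_, rfl⟩
  have q1 : c2 * a ^ 2 + c1 * a + c0 = 0 := by
    rw [h2, h1, h0]; linear_combination hh
  have q2 : a * (a - b) * (2 * c2 * a + c1) = 0 := by
    rw [h2, h1]
    linear_combination μ * ea' - (μ * (a - b) - 2 * a) * hh
  have q3 : (c2 * b ^ 2 + c1 * b + c0) * (μ * (b - a) - 2 * b) +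
      b * (b - a) * (2 * c2 * b + c1) = 0 := by
    rw [h2, h1, h0]
    linear_combination μ * eb'
  have q2' : c1 = - 2 * c2 * a := by
    have := (mul_eq_zero.1 q2).resolve_left (mul_ne_zero ha hab')
    linear_combination this
  have q1' : c0 = c2 * a ^ 2 := by rw [q2'] at q1; linear_combination q1
  have : c2 * (μ * (b - a) ^ 3) = 0 := by
    rw [q1', q2'] at q3; linear_combination q3
  have c20 : c2 = 0 := (mul_eq_zero.1 this).resolve_right (mul_ne_zero hμ (pow_ne_zero _ hba'))
  rw [c20] at h2 q1' q2'
  refine ⟨h, fun x => ?_⟩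
  linear_combination -x ^ 2 * h2 + x * (q2' - h1) + (q1' - h0)

/-- For `p = (x - u)(x - v)(x - z)` the equations say `(a - b) p'(a) = 2 p(a)` and `(b - a) p'(b) =
2 p(b)`. Hence `(a - b)(p'(a) + p'(b)) = 2 (p(a) - p(b))`, but for a monic cubic the two sides
differ by `(a - b)^3`. -/
theorem weight_ne_zero {u v z a b : ℂ} (hab : a ≠ b)
    (hau : a ≠ u) (hav : a ≠ v) (haz : a ≠ z) (hbu : b ≠ u) (hbv : b ≠ v) (hbz : b ≠ z)
    (ea : 1 / (a - u) + (1 / (a - v) + 1 / (a - z)) - 2 / (a - b) = 0)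
    (eb : 1 / (b - u) + (1 / (b - v) + 1 / (b - z)) - 2 / (b - a) = 0) : False := by
  have hab' := sub_ne_zero.2 hab
  have hba' := sub_ne_zero.2 hab.symm
  have hau' := sub_ne_zero.2 hau
  have hav' := sub_ne_zero.2 hav
  have haz' := sub_ne_zero.2 haz
  have hbu' := sub_ne_zero.2 hbu
  have hbv' := sub_ne_zero.2 hbv
  have hbz' := sub_ne_zero.2 hbz
  have ea' : (a - b) * ((a - v) * (a - z) + (a - u) * (a - z) + (a - u) * (a - v)) =
      2 * ((a - u) * (a - v) * (a - z)) := by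
    field_simp at ea
    linear_combination ea
  have eb' : (b - a) * ((b - v) * (b - z) + (b - u) * (b - z) + (b - u) * (b - v)) =
      2 * ((b - u) * (b - v) * (b - z)) := by
    field_simp at eb
    linear_combination eb
  exact pow_ne_zero 3 hab' (by linear_combination ea' - eb')

/-! ### Tails of pairs and the reflection step. -/

/-- `∑ 1 / (x - s)` over `s ∈ {a, b}` -/
noncomputable def pairPoles (a b x : ℂ) : ℂ := 1 / (x - a) + 1 / (x - b)

/-- The Bethe ansatz equations of the last `n + 1` colours `k, …, k + n`, when each of them has two
variables `a j`, `b j`. The colour `k` carries the label `μ` and interacts with the previous colours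
through the function `f`. The label of the last colour is halved. -/
def Tail (w : ℕ → ℝ) (a b : ℕ → ℂ) : ℕ → ℕ → ℝ → (ℂ → ℂ) → Prop
  | 0, k, μ, f => a k ≠ b k ∧ (μ ≠ 0 → a k ≠ 0 ∧ b k ≠ 0) ∧
      μ / a k + f (a k) - 1 / (a k - b k) = 0 ∧ μ / b k + f (b k) - 1 / (b k - a k) = 0
  | n + 1, k, μ, f => a k ≠ b k ∧ (μ ≠ 0 → a k ≠ 0 ∧ b k ≠ 0) ∧
      (a k ≠ a (k + 1) ∧ a k ≠ b (k + 1) ∧ b k ≠ a (k + 1) ∧ b k ≠ b (k + 1)) ∧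
      μ / a k + f (a k) + pairPoles (a (k + 1)) (b (k + 1)) (a k) - 2 / (a k - b k) = 0 ∧
      μ / b k + f (b k) + pairPoles (a (k + 1)) (b (k + 1)) (b k) - 2 / (b k - a k) = 0 ∧
      Tail w a b n (k + 1) (w (k + 1)) (pairPoles (a k) (b k))

variable {w : ℕ → ℝ} {a b : ℕ → ℂ}

theorem Tail.ne {n k : ℕ} {μ : ℝ} {f : ℂ → ℂ} (h : Tail w a b n k μ f) : a k ≠ b k := by
  cases n <;> exact h.1

theorem Tail.ne_zero {n k : ℕ} {μ : ℝ} {f : ℂ → ℂ} (h : Tail w a b n k μ f) (hμ : μ ≠ 0) :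
    a k ≠ 0 ∧ b k ≠ 0 := by
  cases n <;> exact h.2.1 hμ

/-- The first colour enters only through the values of `μ / x + f x` at its two variables; this lets
a reflected neighbour replace the original one. -/
theorem Tail.congr {n k : ℕ} {μ ν : ℝ} {f g : ℂ → ℂ} (h : Tail w a b n k μ f)
    (hν : ν ≠ 0 → a k ≠ 0 ∧ b k ≠ 0)
    (ha : (ν : ℂ) / a k + g (a k) = μ / a k + f (a k))
    (hb : (ν : ℂ) / b k + g (b k) = μ / b k + f (b k)) : Tail w a b n k ν g := by
  cases n with
  | zero =>
    obtain ⟨h1, -, h3, h4⟩ := h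
    exact ⟨h1, hν, by rw [ha, h3], by rw [hb, h4]⟩
  | succ n =>
    obtain ⟨h1, -, h2, h3, h4, h5⟩ := h
    exact ⟨h1, hν, h2, by rw [ha, h3], by rw [hb, h4], h5⟩

theorem mul_weight_div {μ : ℝ} {x : ℂ} (h : μ ≠ 0 → x ≠ 0) : x * (μ / x) = μ := by
  by_cases hμ : μ = 0
  · simp [hμ]
  · have := h hμ
    field_simp

/-- The sum of all equations, each multiplied by its variable. -/
theorem Tail.sum_eq {n k : ℕ} {μ : ℝ} {f : ℂ → ℂ} (h : Tail w a b n k μ f) :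
    a k * f (a k) + b k * f (b k) =
      ((1 - 2 * (μ + ∑ i ∈ Finset.range n, (w (k + 1 + i) + 1)) : ℝ) : ℂ) := by
  induction n generalizing k μ f with
  | zero =>
    obtain ⟨h1, h2, h3, h4⟩ := h
    have ea := mul_weight_div fun h => (h2 h).1
    have eb := mul_weight_div fun h => (h2 h).2
    have e1 : a k * (1 / (a k - b k)) + b k * (1 / (b k - a k)) = 1 := by
      have := sub_ne_zero.2 h1
      rw [← neg_sub (a k) (b k)]
      field_simp
      ring
    push_cast
    simp only [Finset.range_zero, Finset.sum_empty]
    linear_combination a k * h3 + b k * h4 + e1 - ea - eb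
  | succ n ih =>
    obtain ⟨h1, h2, ⟨g1, g2, g3, g4⟩, h3, h4, h5⟩ := h
    have ea := mul_weight_div fun h => (h2 h).1
    have eb := mul_weight_div fun h => (h2 h).2
    have e1 : a k * (2 / (a k - b k)) + b k * (2 / (b k - a k)) = 2 := by
      have := sub_ne_zero.2 h1
      rw [← neg_sub (a k) (b k)]
      field_simp
      ring
    -- Two interacting variables contribute a constant, so only `f` survives in the weighted sum.
    have e2 : ∀ x y : ℂ, x ≠ y → x * (1 / (x - y)) + y * (1 / (y - x)) = 1 := by
      intro x y hxy
      have := sub_ne_zero.2 hxy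
      rw [← neg_sub x y]
      field_simp
      ring
    have := ih h5
    rw [Finset.sum_range_succ']
    simp only [pairPoles] at *
    push_cast at this ⊢
    have e3 : ∀ i, w (k + 1 + (i + 1)) = w (k + 1 + 1 + i) := fun i => by congr 1; ring
    simp only [e3, add_zero]
    linear_combination a k * h3 + b k * h4 + e1 - ea - eb + this - e2 _ _ g1 - e2 _ _ g2
      - e2 _ _ g3 - e2 _ _ g4

/-- `M`, the same at all stages. -/
noncomputable def tailTotal (w : ℕ → ℝ) (n k : ℕ) (μ : ℝ) : ℝ :=
  2 * (μ + ∑ i ∈ Finset.range n, (w (k + 1 + i) + 1))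

/-- Reflection raises the next label by `μ + 1`, so this is the invariance of `M`. -/
theorem tailTotal_succ (w : ℕ → ℝ) (n k : ℕ) (μ : ℝ) :
    tailTotal w (n + 1) k μ = tailTotal w n (k + 1) (w (k + 1) + μ + 1) := by
  unfold tailTotal
  rw [Finset.sum_range_succ']
  have e3 : ∀ i, w (k + 1 + (i + 1)) = w (k + 1 + 1 + i) := fun i => by congr 1; ring
  simp only [e3, add_zero]
  ring

theorem le_tailTotal (hw : ∀ j, 0 ≤ w j) (n k : ℕ) (μ : ℝ) :
    2 * μ + 2 * n ≤ tailTotal w n k μ := by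
  unfold tailTotal
  have : ∑ i ∈ Finset.range n, (1 : ℝ) ≤ ∑ i ∈ Finset.range n, (w (k + 1 + i) + 1) :=
    Finset.sum_le_sum fun i _ => by linarith [hw (k + 1 + i)]
  simp at this
  linarith

/-- With `u = 0` the weighted sum would read `2 = 1 - M`, against `M ≥ 0`. -/
theorem Tail.left_ne_zero (hw : ∀ j, 0 ≤ w j) {n k : ℕ} {μ : ℝ} (hμ : 0 < μ) {u : ℂ}
    (h : Tail w a b n k μ fun x => 1 / (x - u)) : u ≠ 0 := by
  rintro rfl
  obtain ⟨ha, hb⟩ := h.ne_zero hμ.ne'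
  have e := h.sum_eq
  simp only [sub_zero, mul_one_div_cancel ha, mul_one_div_cancel hb] at e
  have e' : (1 + 1 : ℝ) = 1 - tailTotal w n k μ := by
    unfold tailTotal; exact_mod_cast e
  have := le_tailTotal hw n k μ
  have : (0:ℝ) ≤ n := by positivity
  linarith

/-- Since `x / (x - u) = 1 + u / (x - u)`, the weighted sum computes the force of the pair on its
left neighbour: that of a label `M + 1`. -/
theorem Tail.pairPoles_left {n k : ℕ} {μ : ℝ} {u : ℂ}
    (h : Tail w a b n k μ fun x => 1 / (x - u)) (ha : a k ≠ u) (hb : b k ≠ u) :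
    u * pairPoles (a k) (b k) u = (tailTotal w n k μ : ℂ) + 1 := by
  have e := h.sum_eq
  have : ((1 - 2 * (μ + ∑ i ∈ Finset.range n, (w (k + 1 + i) + 1)) : ℝ) : ℂ) =
      1 - (tailTotal w n k μ : ℂ) := by unfold tailTotal; push_cast; ring
  rw [this] at e
  have e1 := sub_ne_zero.2 ha
  have e2 := sub_ne_zero.2 hb
  unfold pairPoles
  rw [← neg_sub (a k) u, ← neg_sub (b k) u]
  have r1 : a k * (1 / (a k - u)) = 1 + u / (a k - u) := by field_simp; ring
  have r2 : b k * (1 / (b k - u)) = 1 + u / (b k - u) := by field_simp; ring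
  rw [r1, r2] at e
  have r3 : u * (1 / -(a k - u) + 1 / -(b k - u)) = - (u / (a k - u)) - u / (b k - u) := by
    field_simp; ring
  rw [r3]
  linear_combination -e

/-- At `x = u` the left side of the identity vanishes and `Tail.pairPoles_left` gives `(M - μ)(u -
h) = u`. At a root of the next colour, dividing by `x y ŷ` gives `y'/y = (μ + 1)/x + 1/(x - h)`, so
the pair can be traded for `h` and a larger label. -/
theorem Tail.exists_step (hw : ∀ j, 0 ≤ w j) {n k : ℕ} {μ : ℝ} (hμ : 0 < μ) {u h : ℂ}
    (ht : Tail w a b (n + 1) k μ fun x => 1 / (x - u)) (ha : a k ≠ u) (hb : b k ≠ u)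
    (hh : h = u * ((tailTotal w (n + 1) k μ - μ - 1) / (tailTotal w (n + 1) k μ - μ))) :
    Reflects μ u (a (k + 1)) (b (k + 1)) (a k) (b k) h ∧ a (k + 1) ≠ h ∧ b (k + 1) ≠ h ∧
      Tail w a b n (k + 1) (w (k + 1) + μ + 1) fun x => 1 / (x - h) := by
  have hu := ht.left_ne_zero hw hμ
  obtain ⟨ha0, hb0⟩ := ht.ne_zero hμ.ne'
  have hab := ht.ne
  have hM := le_tailTotal hw (n + 1) k μ
  have hp := ht.pairPoles_left ha hb
  generalize tailTotal w (n + 1) k μ = M at *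
  have hM2 : 0 < M - μ - 1 := by
    push_cast at hM
    have : (0:ℝ) ≤ n := by positivity
    linarith
  have hM1 : 0 < M - μ := by linarith
  have hM1' : (M : ℂ) - μ ≠ 0 := by exact_mod_cast hM1.ne'
  have hM2' : (M : ℂ) - μ - 1 ≠ 0 := by exact_mod_cast hM2.ne'
  have hμ' : (μ : ℂ) ≠ 0 := by exact_mod_cast hμ.ne'
  have hh0 : h ≠ 0 := by rw [hh]; exact mul_ne_zero hu (div_ne_zero hM2' hM1')
  obtain ⟨-, -, ⟨g1, g2, g3, g4⟩, ea, eb, tl⟩ := ht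
  obtain ⟨h', R⟩ := exists_reflects (u := u) (v := a (k + 1)) (z := b (k + 1)) hμ' ha0 hb0 hab
    ha g1 g2 hb g3 g4 ea eb
  have hhh : h' = h := by
    have Ru := R u
    have n1 := sub_ne_zero.2 ha.symm
    have n2 := sub_ne_zero.2 hb.symm
    unfold pairPoles at hp
    have hp' : u * (2 * u - a k - b k) = (M + 1) * ((u - a k) * (u - b k)) := by
      field_simp at hp
      linear_combination hp
    have : ((u - a k) * (u - b k)) * ((M - μ) * (u - h') - u) = 0 := by
      linear_combination Ru - (u - h') * hp'
    have := (mul_eq_zero.1 this).resolve_left (mul_ne_zero n1 n2)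
    rw [hh]
    field_simp
    linear_combination -this
  subst hhh
  have hyne : ∀ x, x = a (k + 1) ∨ x = b (k + 1) → x - a k ≠ 0 ∧ x - b k ≠ 0 := by
    rintro x (rfl | rfl)
    · exact ⟨sub_ne_zero.2 g1.symm, sub_ne_zero.2 g3.symm⟩
    · exact ⟨sub_ne_zero.2 g2.symm, sub_ne_zero.2 g4.symm⟩
  have hne0 : ∀ x, x = a (k + 1) ∨ x = b (k + 1) → x ≠ 0 := by
    rintro x hx rfl
    have := R 0
    have e : (0 : ℂ) = (μ + 1) * (-(a k * b k * h')) := by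
      rcases hx with hx | hx <;> rw [← hx] at this <;> linear_combination this
    have e1 : (μ : ℂ) + 1 ≠ 0 := by
      have : μ + 1 ≠ 0 := by linarith
      exact_mod_cast this
    exact (mul_ne_zero e1 (neg_ne_zero.2 (mul_ne_zero (mul_ne_zero ha0 hb0) hh0))) e.symm
  have hR : ∀ x, x = a (k + 1) ∨ x = b (k + 1) →
      (μ + 1) * ((x - a k) * (x - b k) * (x - h')) +
      x * ((x - a k) * (x - b k) - (2 * x - a k - b k) * (x - h')) = 0 := by
    intro x hx
    rw [← R x]
    rcases hx with hx | hx <;> rw [hx] <;> ring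
  have hxh : ∀ x, x = a (k + 1) ∨ x = b (k + 1) → x ≠ h' := by
    intro x hx hxh
    have := hR x hx
    rw [← hxh] at this
    obtain ⟨n1, n2⟩ := hyne x hx
    exact mul_ne_zero (hne0 x hx) (mul_ne_zero n1 n2) (by linear_combination this)
  have key : ∀ x, x = a (k + 1) ∨ x = b (k + 1) →
      ((w (k + 1) + μ + 1 : ℝ) : ℂ) / x + 1 / (x - h') =
        (w (k + 1) : ℂ) / x + pairPoles (a k) (b k) x := by
    intro x hx
    obtain ⟨n1, n2⟩ := hyne x hx
    have n3 := hne0 x hx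
    have n4 := sub_ne_zero.2 (hxh x hx)
    have := hR x hx
    unfold pairPoles
    push_cast
    field_simp
    linear_combination this
  refine ⟨R, hxh _ (.inl rfl), hxh _ (.inr rfl), tl.congr (fun _ => ?_) ?_ ?_⟩
  · exact ⟨hne0 _ (.inl rfl), hne0 _ (.inr rfl)⟩
  · exact key _ (.inl rfl)
  · exact key _ (.inr rfl)

theorem Tail.of_step {n k : ℕ} {μ : ℝ} (hw : 0 ≤ w (k + 1)) (hμ : 0 < μ) {u h : ℂ} (hu : u ≠ 0)
    (huh : u ≠ h) (ha0 : a k ≠ 0) (hb0 : b k ≠ 0) (hab : a k ≠ b k)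
    (R : Reflects μ u (a (k + 1)) (b (k + 1)) (a k) (b k) h)
    (ha : a (k + 1) ≠ h) (hb : b (k + 1) ≠ h)
    (ht : Tail w a b n (k + 1) (w (k + 1) + μ + 1) fun x => 1 / (x - h)) :
    a k ≠ u ∧ b k ≠ u ∧ Tail w a b (n + 1) k μ fun x => 1 / (x - u) := by
  have hμ1 : w (k + 1) + μ + 1 ≠ 0 := by linarith
  obtain ⟨v0, z0⟩ := ht.ne_zero hμ1
  have hμ' : (μ : ℂ) ≠ 0 := by exact_mod_cast hμ.ne'
  have n1 := sub_ne_zero.2 hab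
  have n1' := sub_ne_zero.2 hab.symm
  -- At a root common to `y` and the left side, the identity reduces to a product of non-zero
  -- factors being `0`.
  have yne : ∀ x, x ≠ 0 → x ≠ h → (x - u) * (x - a (k + 1)) * (x - b (k + 1)) = 0 →
      x ≠ a k ∧ x ≠ b k := by
    intro x x0 xh hx
    have := R x
    rw [hx] at this
    constructor <;> rintro rfl
    · exact mul_ne_zero (mul_ne_zero x0 n1) (sub_ne_zero.2 xh) (by linear_combination this)
    · exact mul_ne_zero (mul_ne_zero x0 n1') (sub_ne_zero.2 xh) (by linear_combination this)
  obtain ⟨u1, u2⟩ := yne u hu huh (by ring)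
  obtain ⟨v1, v2⟩ := yne _ v0 ha (by ring)
  obtain ⟨z1, z2⟩ := yne _ z0 hb (by ring)
  have key : ∀ x, x ≠ 0 → x ≠ h → x ≠ a k → x ≠ b k →
      (x - a (k + 1)) * (x - b (k + 1)) = 0 → (w (k + 1) : ℂ) / x + pairPoles (a k) (b k) x =
      ((w (k + 1) + μ + 1 : ℝ) : ℂ) / x + 1 / (x - h) := by
    intro x x0 xh xa xb hx
    have := R x
    have n1 := sub_ne_zero.2 xa
    have n2 := sub_ne_zero.2 xb
    have n4 := sub_ne_zero.2 xh
    unfold pairPoles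
    push_cast
    field_simp
    linear_combination this - μ * (x - u) * hx
  have eqn : ∀ a' b', a' ≠ 0 → a' ≠ b' → a' ≠ u → a' ≠ a (k + 1) → a' ≠ b (k + 1) →
      Reflects μ u (a (k + 1)) (b (k + 1)) a' b' h →
      μ / a' + 1 / (a' - u) + pairPoles (a (k + 1)) (b (k + 1)) a' - 2 / (a' - b') = 0 := by
    intro a' b' a0 hab au av az R
    have d1 := R a'
    have n1 := sub_ne_zero.2 hab
    have n2 := sub_ne_zero.2 au
    have n3 := sub_ne_zero.2 av
    have n4 := sub_ne_zero.2 az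
    generalize a (k + 1) = v at *
    generalize b (k + 1) = z at *
    have h1 := R 0
    have h2 := R 1
    have h3 := R (-1)
    -- This is the derivative of the identity at `a'`; as the cubic terms agree, the values at `0`,
    -- `1`, `-1` give the remaining coefficients.
    have d2 : μ * ((a' - v) * (a' - z) + (a' - u) * (a' - z) + (a' - u) * (a' - v)) =
        (μ) * ((a' - b') * (a' - h)) - 2 * a' * (a' - h) := by
      linear_combination (1/2) * (h2 - h3) - (1/2) * (2 * a') * (2 * h1 - h2 - h3)
    have : (μ * (a' - b') - 2 * a') * ((a' - u) * (a' - v) * (a' - z)) + a' * (a' - b') *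
        ((a' - v) * (a' - z) + (a' - u) * (a' - z) + (a' - u) * (a' - v)) = 0 := by
      apply mul_left_cancel₀ hμ'
      linear_combination a' * (a' - b') * d2 + (μ * (a' - b') - 2 * a') * d1
    unfold pairPoles
    field_simp
    linear_combination this
  refine ⟨u1.symm, u2.symm, hab, fun _ => ⟨ha0, hb0⟩, ⟨v1.symm, z1.symm, v2.symm, z2.symm⟩,
    eqn _ _ ha0 hab u1.symm v1.symm z1.symm R,
    eqn _ _ hb0 hab.symm u2.symm v2.symm z2.symm (fun x => (R x).trans (by ring)), ht.congr ?_ ?_ ?_⟩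
  · exact fun _ => ⟨v0, z0⟩
  · exact key _ v0 ha v1 v2 (by ring)
  · exact key _ z0 hb z1 z2 (by ring)

/-! ### The last pair, and undoing one reflection. -/

theorem Tail.zero_iff {k : ℕ} {μ : ℝ} (hμ : 0 ≤ μ) {u : ℂ} :
    (a k ≠ u ∧ b k ≠ u ∧ Tail w a b 0 k μ fun x => 1 / (x - u)) ↔
      a k ≠ b k ∧ a k ≠ 0 ∧ b k ≠ 0 ∧ μ ≠ 0 ∧ u ≠ 0 ∧
      μ * (a k + b k) = u * (2 * μ - 1) ∧ (2 * μ + 1) * (a k * b k) = u ^ 2 * (2 * μ - 1) := by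
  have hμ1 : (2 * μ + 1 : ℂ) ≠ 0 := by
    have : 2 * μ + 1 ≠ 0 := by linarith
    exact_mod_cast this
  have cast0 : (μ : ℂ) = 0 ↔ μ = 0 := by norm_cast
  rw [ne_eq μ, ← cast0]
  constructor
  · rintro ⟨ha, hb, hab, h0, ea, eb⟩
    rw [ne_eq μ, ← cast0] at h0
    generalize a k = a at *
    generalize b k = b at *
    generalize (μ : ℂ) = μ at *
    have n1 := sub_ne_zero.2 ha
    have n2 := sub_ne_zero.2 hb
    have n3 := sub_ne_zero.2 hab
    have n3' := sub_ne_zero.2 hab.symm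
    have h0' : μ ≠ 0 := by
      rintro rfl
      rw [zero_div, zero_add, sub_eq_zero, div_eq_div_iff n1 n3] at ea
      exact n2 (by linear_combination -ea)
    obtain ⟨a0, b0⟩ := h0 h0'
    have ea' : μ * (a - u) * (a - b) + a * (u - b) = 0 := by
      field_simp at ea; linear_combination ea
    have eb' : μ * (b - u) * (b - a) + b * (u - a) = 0 := by
      field_simp at eb; linear_combination eb
    -- The difference of the cleared equations is divisible by `a - b` and gives the sum; their sum
    -- then gives the product.
    have e1 : μ * (a + b) = u * (2 * μ - 1) :=
      mul_left_cancel₀ n3 (by linear_combination ea' - eb')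
    have e2 : (2 * μ + 1) * (a * b) = u ^ 2 * (2 * μ - 1) := by
      apply mul_left_cancel₀ (two_ne_zero (α := ℂ))
      linear_combination - ea' - eb' + (a + b + 2 * u) * e1
    refine ⟨hab, a0, b0, h0', ?_, e1, e2⟩
    rintro rfl
    exact mul_ne_zero hμ1 (mul_ne_zero a0 b0) (by linear_combination e2)
  · rintro ⟨hab, a0, b0, h0, hu, e1, e2⟩
    have nu : ∀ x y : ℂ, μ * (x + y) = u * (2 * μ - 1) →
        (2 * μ + 1) * (x * y) = u ^ 2 * (2 * μ - 1) → x ≠ u := by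
      rintro x y e1 e2 rfl
      exact hu (pow_eq_zero_iff (n := 2) (by norm_num) |>.1
        (by linear_combination (2 * μ + 1) * x * e1 - μ * e2))
    have n1 := nu _ _ e1 e2
    have n2 := nu (b k) (a k) (by linear_combination e1) (by linear_combination e2)
    refine ⟨n1, n2, hab, fun _ => ⟨a0, b0⟩, ?_, ?_⟩
    all_goals
      generalize a k = a at *
      generalize b k = b at *
      generalize (μ : ℂ) = μ at *
      have m1 := sub_ne_zero.2 n1
      have m2 := sub_ne_zero.2 n2
      have n3 := sub_ne_zero.2 hab
      have n3' := sub_ne_zero.2 hab.symm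
      field_simp
    · linear_combination ((1/2) * (a - b) + (1/2) * (a + b + 2 * u)) * e1 - e2
    · linear_combination ((-1/2) * (a - b) + (1/2) * (a + b + 2 * u)) * e1 - e2

theorem reflects_iff {μ u v z a b h : ℂ} : Reflects μ u v z a b h ↔
    (μ + 1) * (a + b) + (μ - 1) * h = μ * (u + (v + z)) ∧
    (μ + 2) * (a * b) + μ * (a + b) * h = μ * (v * z + u * (v + z)) ∧
    (μ + 1) * (a * b) * h = μ * u * (v * z) := by
  constructor
  · intro R
    have h0 := R 0
    have h1 := R 1
    have h2 := R (-1)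
    refine ⟨?_, ?_, ?_⟩
    · linear_combination (1/2) * (h1 + h2 - 2 * h0)
    · linear_combination (1/2) * (h2 - h1)
    · linear_combination h0
  · rintro ⟨h1, h2, h3⟩ x
    linear_combination x ^ 2 * h1 - x * h2 + h3

/-- Undoing a reflection preserves the shape of the sum and product, with `h` replaced by `u` and
`c` by `c μ / (μ + 1)`. The quadratic and constant coefficients determine `a + b` and `a b`; the
linear one then holds by the relation between `h` and `u`. -/
theorem reflects_iff_closed {μ u v z a b h M c : ℂ} (h0 : μ ≠ 0) (h1 : μ + 1 ≠ 0) (hM0 : M ≠ 0)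
    (hM1 : M + 1 ≠ 0) (hMμ : M - μ ≠ 0) (hMμ1 : M - μ - 1 ≠ 0) (hu : u ≠ 0)
    (hh : h = u * ((M - μ - 1) / (M - μ)))
    (hs : v + z = (M - 1) / M * (h + c)) (hp : v * z = (M - 1) / (M + 1) * (h * c)) :
    Reflects μ u v z a b h ↔ a + b = (M - 1) / M * (u + c * (μ / (μ + 1))) ∧
      a * b = (M - 1) / (M + 1) * (u * (c * (μ / (μ + 1)))) := by
  rw [reflects_iff, hs, hp]
  have hh0 : h ≠ 0 := by rw [hh]; exact mul_ne_zero hu (div_ne_zero hMμ1 hMμ)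
  have hs' : (μ + 1) * (a + b) + (μ - 1) * h = μ * (u + (M - 1) / M * (h + c)) ↔
      a + b = (M - 1) / M * (u + c * (μ / (μ + 1))) := by
    have : (μ + 1) * ((M - 1) / M * (u + c * (μ / (μ + 1)))) + (μ - 1) * h =
        μ * (u + (M - 1) / M * (h + c)) := by
      rw [hh]; field_simp; ring
    rw [← this, add_left_inj, mul_right_inj' h1]
  have hp' : (μ + 1) * (a * b) * h = μ * u * ((M - 1) / (M + 1) * (h * c)) ↔
      a * b = (M - 1) / (M + 1) * (u * (c * (μ / (μ + 1)))) := by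
    have : μ * u * ((M - 1) / (M + 1) * (h * c)) =
        (μ + 1) * ((M - 1) / (M + 1) * (u * (c * (μ / (μ + 1))))) * h := by
      field_simp
    rw [this, mul_left_inj' hh0, mul_right_inj' h1]
  rw [hs', hp']
  constructor
  · exact fun h => ⟨h.1, h.2.2⟩
  · rintro ⟨e1, e2⟩
    refine ⟨e1, ?_, e2⟩
    rw [e1, e2, hh]
    field_simp
    ring

/-! ### Closed form and existence for a tail. -/

variable {w : ℕ → ℝ} {a b : ℕ → ℂ}

theorem exists_sum_prod (s p : ℂ) : ∃ x y : ℂ, x + y = s ∧ x * y = p := by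
  obtain ⟨d, hd⟩ := IsAlgClosed.exists_pow_nat_eq (s ^ 2 - 4 * p) (n := 2) (by norm_num)
  exact ⟨(s + d) / 2, (s - d) / 2, by ring, by linear_combination (-1/4) * hd⟩

/-- The parameters of the successive reflections of a `Tail`: the labels `μ`, the roots `u` of the
reflected polynomials and the products `H`. -/
structure TailData (w : ℕ → ℝ) (k r : ℕ) (μ : ℕ → ℝ) (u H : ℕ → ℂ) : Prop where
  le : k ≤ r
  nonneg : ∀ j, 0 ≤ w j
  weight : ∀ j, k ≤ j → j < r → μ (j + 1) = w (j + 1) + μ j + 1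
  root : ∀ j, k ≤ j → j < r →
    u (j + 1) = u j * ((2 * (μ r : ℂ) - μ j - 1) / (2 * (μ r : ℂ) - μ j))
  last : H r = 1
  factor : ∀ j, k ≤ j → j < r → H j = H (j + 1) * ((μ j : ℂ) / (μ j + 1))

namespace TailData

variable {k r : ℕ} {μ : ℕ → ℝ} {u H : ℕ → ℂ}

/-- At the last colour the total is `2 * μ r`, so this is the invariant `M` in all formulas below.
-/
theorem tailTotal_eq (D : TailData w k r μ u H) (n j : ℕ) (hk : k ≤ j) (hn : j + n = r) :
    tailTotal w n j (μ j) = 2 * μ r := by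
  induction n generalizing j with
  | zero => simp [tailTotal, ← hn]
  | succ n ih =>
    rw [tailTotal_succ, ← D.weight j hk (by omega)]
    exact ih (j + 1) (by omega) (by omega)

theorem pos (D : TailData w k r μ u H) (h : 0 < μ k) (j : ℕ) (hk : k ≤ j) (hj : j ≤ r) :
    0 < μ j := by
  induction j, hk using Nat.le_induction with
  | base => exact h
  | succ j hk ih =>
    rw [D.weight j hk (by omega)]
    linarith [ih (by omega), D.nonneg (j + 1)]

theorem gap (D : TailData w k r μ u H) (h : 0 < μ k) (j : ℕ) (hk : k ≤ j) (hj : j < r) :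
    0 < 2 * μ r - μ j - 1 := by
  have := le_tailTotal D.nonneg (r - j) j (μ j)
  rw [D.tailTotal_eq _ j hk (by omega)] at this
  have h1 : (1 : ℝ) ≤ (r - j : ℕ) := by exact_mod_cast (by omega : 1 ≤ r - j)
  linarith [D.pos h j hk hj.le]

theorem casts (D : TailData w k r μ u H) (h : 0 < μ k) (j : ℕ) (hk : k ≤ j) (hj : j < r) :
    (μ j : ℂ) ≠ 0 ∧ (μ j : ℂ) + 1 ≠ 0 ∧ 2 * (μ r : ℂ) - μ j ≠ 0 ∧
      2 * (μ r : ℂ) - μ j - 1 ≠ 0 := by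
  have h1 := D.pos h j hk hj.le
  have h2 := D.gap h j hk hj
  have h3 : μ j + 1 ≠ 0 := by linarith
  have h4 : 2 * μ r - μ j ≠ 0 := by linarith
  exact ⟨by exact_mod_cast h1.ne', by exact_mod_cast h3, by exact_mod_cast h4,
    by exact_mod_cast h2.ne'⟩

theorem casts_last (D : TailData w k r μ u H) (h : 0 < μ k) :
    2 * (μ r : ℂ) ≠ 0 ∧ 2 * (μ r : ℂ) + 1 ≠ 0 := by
  have h1 := D.pos h r D.le le_rfl
  have h2 : 2 * μ r ≠ 0 := by linarith
  have h3 : 2 * μ r + 1 ≠ 0 := by linarith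
  exact ⟨by exact_mod_cast h2, by exact_mod_cast h3⟩

theorem root_ne_zero (D : TailData w k r μ u H) (h : 0 < μ k) (hu : u k ≠ 0) (j : ℕ) (hk : k ≤ j)
    (hj : j ≤ r) : u j ≠ 0 := by
  induction j, hk using Nat.le_induction with
  | base => exact hu
  | succ j hk ih =>
    obtain ⟨-, -, h1, h2⟩ := D.casts h j hk hj
    rw [D.root j hk hj]
    exact mul_ne_zero (ih (by omega)) (div_ne_zero h2 h1)

theorem tail (D : TailData w k r μ u H) (h : 0 < μ k)
    (ht : Tail w a b (r - k) k (μ k) fun x => 1 / (x - u k)) (ha : a k ≠ u k) (hb : b k ≠ u k)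
    (j : ℕ) (hk : k ≤ j) (hj : j ≤ r) : a j ≠ u j ∧ b j ≠ u j ∧
      Tail w a b (r - j) j (μ j) fun x => 1 / (x - u j) := by
  induction j, hk using Nat.le_induction with
  | base => exact ⟨ha, hb, ht⟩
  | succ j hk ih =>
    obtain ⟨ha, hb, ht⟩ := ih (by omega)
    obtain ⟨n, hn⟩ : ∃ n, r - j = n + 1 := ⟨r - j - 1, by omega⟩
    have hn' : r - (j + 1) = n := by omega
    rw [hn] at ht
    obtain ⟨-, g1, g2, g3⟩ := ht.exists_step D.nonneg (D.pos h j hk (by omega)) ha hb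
      (h := u (j + 1)) (by
        rw [D.tailTotal_eq _ j hk (by omega), D.root j hk (by omega)]; push_cast; rfl)
    rw [hn', D.weight j hk (by omega)]
    exact ⟨g1, g2, g3⟩

theorem reflects (D : TailData w k r μ u H) (h : 0 < μ k)
    (ht : Tail w a b (r - k) k (μ k) fun x => 1 / (x - u k)) (ha : a k ≠ u k) (hb : b k ≠ u k)
    (j : ℕ) (hk : k ≤ j) (hj : j < r) :
    Reflects (μ j) (u j) (a (j + 1)) (b (j + 1)) (a j) (b j) (u (j + 1)) := by
  obtain ⟨ha, hb, ht⟩ := D.tail h ht ha hb j hk hj.le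
  obtain ⟨n, hn⟩ : ∃ n, r - j = n + 1 := ⟨r - j - 1, by omega⟩
  rw [hn] at ht
  exact (ht.exists_step D.nonneg (D.pos h j hk hj.le) ha hb (h := u (j + 1)) (by
      rw [D.tailTotal_eq _ j hk (by omega), D.root j hk hj]; push_cast; rfl)).1

/-- Closed form of the elementary symmetric functions of the pairs. -/
theorem closed_form (D : TailData w k r μ u H) (h : 0 < μ k)
    (ht : Tail w a b (r - k) k (μ k) fun x => 1 / (x - u k)) (ha : a k ≠ u k) (hb : b k ≠ u k)
    (j : ℕ) (hk : k ≤ j) (hj : j ≤ r) :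
    a j + b j = (2 * (μ r : ℂ) - 1) / (2 * (μ r : ℂ)) * (u j + u r * H j) ∧
    a j * b j = (2 * (μ r : ℂ) - 1) / (2 * (μ r : ℂ) + 1) * (u j * (u r * H j)) := by
  have hu : u k ≠ 0 := ht.left_ne_zero D.nonneg h
  obtain ⟨hM0, hM1⟩ := D.casts_last h
  induction hj using Nat.decreasingInduction with
  | self =>
    obtain ⟨ha, hb, ht⟩ := D.tail h ht ha hb r hk le_rfl
    rw [Nat.sub_self] at ht
    obtain ⟨-, -, -, h0, -, e1, e2⟩ :=
      (Tail.zero_iff (D.pos h r hk le_rfl).le).1 ⟨ha, hb, ht⟩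
    have h0' : (μ r : ℂ) ≠ 0 := by exact_mod_cast h0
    rw [D.last]
    constructor
    · field_simp
      linear_combination 2 * e1
    · field_simp
      linear_combination e2
  | of_succ j hj ih =>
    obtain ⟨i1, i2⟩ := ih (by omega)
    obtain ⟨c1, c2, c3, c4⟩ := D.casts h j hk hj
    rw [D.factor j hk hj, ← mul_assoc]
    exact (reflects_iff_closed c1 c2 hM0 hM1 c3 c4 (D.root_ne_zero h hu j hk hj.le)
      (D.root j hk hj) i1 i2).1 (D.reflects h ht ha hb j hk hj)

/-- The ratio `q` is a product of real factors in `(0, 1]`, one for each colour from `j` to `r - 1`,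
so it is at most its first factor. -/
theorem exists_ratio (D : TailData w k r μ u H) (h : 0 < μ k) (j : ℕ) (hk : k ≤ j) (hj : j ≤ r) :
    ∃ q : ℝ, u r * H j = u j * q ∧ 0 < q ∧ q ≤ 1 ∧
      (j < r → q ≤ μ j * (2 * μ r - μ j - 1) / ((μ j + 1) * (2 * μ r - μ j))) ∧
      (j = r → q = 1) := by
  induction hj using Nat.decreasingInduction with
  | self => exact ⟨1, by simp [D.last], one_pos, le_rfl, by simp, by simp⟩
  | of_succ j hj ih =>
    obtain ⟨q, e1, e2, e3, -, -⟩ := ih (by omega)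
    have m0 := D.pos h j hk hj.le
    have m1 := D.gap h j hk hj
    have m2 : 0 < 2 * μ r - μ j := by linarith
    have hf : 0 < μ j * (2 * μ r - μ j - 1) / ((μ j + 1) * (2 * μ r - μ j)) := by positivity
    have hf1 : μ j * (2 * μ r - μ j - 1) / ((μ j + 1) * (2 * μ r - μ j)) ≤ 1 := by
      rw [div_le_one (by positivity)]
      nlinarith
    refine ⟨q * (μ j * (2 * μ r - μ j - 1) / ((μ j + 1) * (2 * μ r - μ j))), ?_, by positivity,
      mul_le_one₀ e3 hf.le hf1, fun _ => mul_le_of_le_one_left hf.le e3, fun h => by omega⟩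
    obtain ⟨c1, c2, c3, c4⟩ := D.casts h j hk hj
    rw [D.factor j hk hj, ← mul_assoc, e1, D.root j hk hj]
    push_cast
    field_simp

/-- Up to a non-zero factor the discriminant is `(M² - 1)(1 - q)² - 4q`. It is `-4` at `q = 1`, the
case `j = r`. For `j < r` it decreases in `q ≤ 1` and is positive already at the upper bound `p` for
`q`. -/
theorem discr_ne_zero (D : TailData w k r μ u H) (h : 0 < μ k) (hr : 1 < 2 * μ r) (hu : u k ≠ 0)
    (j : ℕ) (hk : k ≤ j) (hj : j ≤ r) :
    ((2 * (μ r : ℂ) - 1) / (2 * (μ r : ℂ)) * (u j + u r * H j)) ^ 2 -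
      4 * ((2 * (μ r : ℂ) - 1) / (2 * (μ r : ℂ) + 1) * (u j * (u r * H j))) ≠ 0 := by
  obtain ⟨q, e1, e2, e3, e4, e5⟩ := D.exists_ratio h j hk hj
  obtain ⟨hM0, hM1⟩ := D.casts_last h
  have hq : ((2 * μ r) ^ 2 - 1) * (1 - q) ^ 2 - 4 * q ≠ 0 := by
    rcases hj.lt_or_eq with hj | hj
    · have e4 := e4 hj
      have m0 := D.pos h j hk hj.le
      have m1 := D.gap h j hk hj
      clear e1 e5 hM0 hM1
      generalize μ j = m at *
      generalize 2 * μ r = M at *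
      have m2 : 0 < M - m := by linarith
      have d : 0 < (m + 1) * (M - m) := by positivity
      obtain ⟨p, hp⟩ : ∃ p, p = m * (M - m - 1) / ((m + 1) * (M - m)) := ⟨_, rfl⟩
      rw [← hp] at e4
      have hp1 : 1 - p = M / ((m + 1) * (M - m)) := by rw [hp]; field_simp; ring
      have hp2 : 0 < 1 - p := by rw [hp1]; exact div_pos (by linarith) d
      have hM : 0 < M ^ 2 - 1 := by nlinarith
      have k1 : (1 - p) ^ 2 ≤ (1 - q) ^ 2 := by gcongr
      have k2 : 4 * p < (M ^ 2 - 1) * (1 - p) ^ 2 := by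
        rw [hp1, hp, div_pow, mul_div_assoc', mul_div_assoc', div_lt_div_iff₀ d (by positivity)]
        -- AM-GM for factors with sums `M - 1` and `M + 1`.
        have x1 : m * (M - m - 1) ≤ ((M - 1) / 2) ^ 2 := by nlinarith [sq_nonneg (M - 1 - 2 * m)]
        have x2 : (m + 1) * (M - m) ≤ ((M + 1) / 2) ^ 2 := by nlinarith [sq_nonneg (M - 1 - 2 * m)]
        have x3 : m * (M - m - 1) * ((m + 1) * (M - m)) ≤ ((M - 1) / 2) ^ 2 * ((M + 1) / 2) ^ 2 :=
          mul_le_mul x1 x2 d.le (by positivity)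
        have x4 : 4 * (m * (M - m - 1)) * ((m + 1) * (M - m)) < (M ^ 2 - 1) * M ^ 2 := by
          nlinarith
        calc 4 * (m * (M - m - 1)) * ((m + 1) * (M - m)) ^ 2
            = (4 * (m * (M - m - 1)) * ((m + 1) * (M - m))) * ((m + 1) * (M - m)) := by ring
          _ < (M ^ 2 - 1) * M ^ 2 * ((m + 1) * (M - m)) := by gcongr
      have k3 : (M ^ 2 - 1) * (1 - p) ^ 2 ≤ (M ^ 2 - 1) * (1 - q) ^ 2 := by gcongr
      linarith
    · rw [e5 hj]; norm_num
  have hq' : ((2 * (μ r : ℂ)) ^ 2 - 1) * (1 - q) ^ 2 - 4 * q ≠ 0 := by exact_mod_cast hq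
  have hM2 : 2 * (μ r : ℂ) - 1 ≠ 0 := by
    have : 2 * μ r - 1 ≠ 0 := by linarith
    exact_mod_cast this
  have huj := D.root_ne_zero h hu j hk hj
  rw [e1]
  generalize 2 * (μ r : ℂ) = M at *
  have : ((M - 1) / M * (u j + u j * q)) ^ 2 - 4 * ((M - 1) / (M + 1) * (u j * (u j * q))) =
      (M - 1) * u j ^ 2 / (M ^ 2 * (M + 1)) * ((M ^ 2 - 1) * (1 - q) ^ 2 - 4 * q) := by
    field_simp
    ring
  rw [this]
  exact mul_ne_zero (div_ne_zero (mul_ne_zero hM2 (pow_ne_zero _ huj))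
    (mul_ne_zero (pow_ne_zero _ hM0) hM1)) hq'

/-- The pairs are the roots of the closed-form quadratics; the equations are checked from the last
colour back by `Tail.of_step`. -/
theorem exists_tail (D : TailData w k r μ u H) (h : 0 < μ k) (hr : 1 < 2 * μ r) (hu : u k ≠ 0) :
    ∃ a b : ℕ → ℂ, a k ≠ u k ∧ b k ≠ u k ∧ Tail w a b (r - k) k (μ k) fun x => 1 / (x - u k) := by
  obtain ⟨hM0, hM1⟩ := D.casts_last h
  have hM2 : 2 * (μ r : ℂ) - 1 ≠ 0 := by
    have : 2 * μ r - 1 ≠ 0 := by linarith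
    exact_mod_cast this
  choose a b hs hp using fun j => exists_sum_prod
    ((2 * (μ r : ℂ) - 1) / (2 * (μ r : ℂ)) * (u j + u r * H j))
    ((2 * (μ r : ℂ) - 1) / (2 * (μ r : ℂ) + 1) * (u j * (u r * H j)))
  have hab : ∀ j, k ≤ j → j ≤ r → a j ≠ b j := by
    intro j hk hj e
    apply D.discr_ne_zero h hr hu j hk hj
    rw [← hs, ← hp, e]
    ring
  have h0 : ∀ j, k ≤ j → j ≤ r → a j ≠ 0 ∧ b j ≠ 0 := by
    intro j hk hj
    rw [← mul_ne_zero_iff, hp]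
    obtain ⟨q, e1, e2, -⟩ := D.exists_ratio h j hk hj
    have e2' : (q : ℂ) ≠ 0 := by exact_mod_cast e2.ne'
    have huj := D.root_ne_zero h hu j hk hj
    rw [e1]
    exact mul_ne_zero (div_ne_zero hM2 hM1) (mul_ne_zero huj (mul_ne_zero huj e2'))
  refine ⟨a, b, ?_⟩
  have key : ∀ j, j ≤ r → k ≤ j →
      a j ≠ u j ∧ b j ≠ u j ∧ Tail w a b (r - j) j (μ j) fun x => 1 / (x - u j) := by
    intro j hj
    induction hj using Nat.decreasingInduction with
    | self =>
      intro hk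
      obtain ⟨x1, x2⟩ := h0 r hk le_rfl
      have h0' : (μ r : ℂ) ≠ 0 := by exact_mod_cast (D.pos h r hk le_rfl).ne'
      rw [Nat.sub_self]
      refine (Tail.zero_iff (D.pos h r hk le_rfl).le).2 ⟨hab r hk le_rfl, x1, x2,
        (D.pos h r hk le_rfl).ne', D.root_ne_zero h hu r hk le_rfl, ?_, ?_⟩
      · rw [hs, D.last]; field_simp; ring
      · rw [hp, D.last]; field_simp
    | of_succ j hj ih =>
      intro hk
      obtain ⟨g1, g2, g3⟩ := ih (by omega)
      obtain ⟨x1, x2⟩ := h0 j hk hj.le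
      obtain ⟨c1, c2, c3, c4⟩ := D.casts h j hk hj
      have huj := D.root_ne_zero h hu j hk hj.le
      have hn : r - j = r - (j + 1) + 1 := by omega
      rw [hn]
      rw [D.weight j hk hj] at g3
      refine Tail.of_step (D.nonneg _) (D.pos h j hk hj.le) huj (fun e => ?_) x1 x2
        (hab j hk hj.le) ?_ g1 g2 g3
      · rw [D.root j hk hj] at e
        field_simp at e
        exact one_ne_zero (α := ℂ) (by linear_combination e)
      · refine (reflects_iff_closed c1 c2 hM0 hM1 c3 c4 huj (D.root j hk hj) (hs (j + 1))
          (hp (j + 1))).2 ?_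
        rw [hs, hp, D.factor j hk hj, mul_assoc (u r)]
        exact ⟨rfl, rfl⟩
  exact key k D.le le_rfl

end TailData

/-! ### Obstructions to solving a tail. -/

/-- There is no solution when the first label of the tail is zero. -/
theorem Tail.weight_pos {n k : ℕ} {μ : ℝ} (hμ : 0 ≤ μ) {u : ℂ}
    (ht : Tail w a b n k μ fun x => 1 / (x - u)) (ha : a k ≠ u) (hb : b k ≠ u) : 0 < μ := by
  refine lt_of_le_of_ne hμ fun h0 => ?_
  cases n with
  | zero => exact ((Tail.zero_iff hμ).1 ⟨ha, hb, ht⟩).2.2.2.1 h0.symm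
  | succ n =>
    obtain ⟨h1, -, ⟨g1, g2, g3, g4⟩, ea, eb, -⟩ := ht
    simp only [← h0, Complex.ofReal_zero, zero_div, zero_add] at ea eb
    exact weight_ne_zero h1 ha g1 g2 hb g3 g4 ea eb

/-- The factor `2 μ - 1` vanishes, so the product of the roots would be zero. -/
theorem Tail.weight_ne_half {k : ℕ} {u : ℂ}
    (ht : Tail w a b 0 k (1 / 2) fun x => 1 / (x - u)) (ha : a k ≠ u) (hb : b k ≠ u) : False := by
  obtain ⟨-, a0, b0, -, -, -, e⟩ := (Tail.zero_iff (by norm_num)).1 ⟨ha, hb, ht⟩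
  push_cast at e
  have := mul_ne_zero a0 b0
  exact this (by linear_combination (1/2) * e)

/-! ### Translation of the Bethe system to two sequences. -/

/-- The number of variables of colour `k` in the numbering `1, …, r`; the colour `0` stands for the
point `1`. -/
def colourCount (r L k : ℕ) : ℕ :=
  if k = 0 then 1 else if r < k then 0 else if L ≤ r then (if k ≤ L then 1 else 0)
  else (if k ≤ 2 * r - L then 1 else 2)

/-- The variables of colour `k` are `a k` and `b k`. -/
def rootOf (a b : ℕ → ℂ) (k i : ℕ) : ℂ := if i = 0 then a k else b k

/-- The labels, the last one halved. -/
noncomputable def halvedLabel {r : ℕ} (lam : Fin r → ℕ) (k : ℕ) : ℝ :=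
  if k = r then (label lam k : ℝ) / 2 else label lam k

theorem halvedLabel_nonneg {r : ℕ} (lam : Fin r → ℕ) (k : ℕ) : 0 ≤ halvedLabel lam k := by
  unfold halvedLabel; split_ifs <;> positivity

/-- The logarithmic derivative at `x` of the polynomial of colour `k`. -/
noncomputable def poleSum (r L : ℕ) (a b : ℕ → ℂ) (k : ℕ) (x : ℂ) : ℂ :=
  ∑ i ∈ Finset.range (colourCount r L k), 1 / (x - rootOf a b k i)

/-- The tuple of variables given by two sequences. -/
def assemble (r L : ℕ) (a b : ℕ → ℂ) : (Σ i : Fin r, Fin (lengthTuple r L i)) → ℂ :=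
  fun p => rootOf a b ((p.1 : ℕ) + 1) p.2

theorem lengthTuple_eq (r L : ℕ) (i : Fin r) : lengthTuple r L i = colourCount r L (i + 1) := by
  have := i.2
  have h : ¬ r < (i : ℕ) + 1 := by omega
  simp [lengthTuple, colourCount, h]

theorem colourCount_le_two (r L k : ℕ) : colourCount r L k ≤ 2 := by
  unfold colourCount; split_ifs <;> omega

theorem exists_assemble {r L : ℕ} (t : (Σ i : Fin r, Fin (lengthTuple r L i)) → ℂ) :
    ∃ a b : ℕ → ℂ, a 0 = 1 ∧ t = assemble r L a b := by
  classical
  let f : ℕ → ℕ → ℂ := fun k m =>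
    if h : ∃ h : k - 1 < r, m < lengthTuple r L ⟨k - 1, h⟩ then t ⟨⟨k - 1, h.1⟩, ⟨m, h.2⟩⟩ else 0
  refine ⟨fun k => if k = 0 then 1 else f k 0, fun k => f k 1, by simp, ?_⟩
  funext ⟨i, m⟩
  have hm : (m : ℕ) = 0 ∨ (m : ℕ) = 1 := by
    have := m.2
    have := lengthTuple_eq r L i
    have := colourCount_le_two r L (i + 1)
    omega
  have key : f (i + 1) m = t ⟨i, m⟩ := by
    have h : ∃ h : (i : ℕ) + 1 - 1 < r, (m : ℕ) < lengthTuple r L ⟨(i : ℕ) + 1 - 1, h⟩ :=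
      ⟨i.2, m.2⟩
    simp only [f]
    rw [dif_pos h]
    rfl
  unfold assemble rootOf
  rcases hm with hm | hm <;> simp [hm, ← key]

theorem rootRoot_B {r : ℕ} (i j : Fin r) :
    rootRoot (cartanB r) (symmB r) i j =
      if (j : ℕ) = i then (if (i : ℕ) + 1 = r then 2 else 4)
      else if (j : ℕ) + 1 = i ∨ (i : ℕ) + 1 = j then -2 else 0 := by
  have hi := i.2
  have hj := j.2
  have e : ∀ x y : Fin r, x = y ↔ (x : ℕ) = y := fun x y => Fin.ext_iff
  simp only [rootRoot, cartanB, symmB, CartanMatrix.B, Matrix.transpose_apply, Matrix.of_apply, e]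
  split_ifs <;> first | (exfalso; omega) | norm_num

theorem rootWeight_B_zero {r : ℕ} (lam : Fin r → ℕ) (i : Fin r) :
    rootWeight (symmB r) i (weightsB lam 0) = 2 * (halvedLabel lam (i + 1) : ℂ) := by
  have hi := i.2
  have : label lam (i + 1) = lam i := by
    unfold label
    rw [dif_pos ⟨by omega, by omega⟩]
    rfl
  simp only [rootWeight, symmB, weightsB, halvedLabel, this]
  split_ifs
  · rw [Complex.ofReal_div]
    simp only [Matrix.cons_val_zero, Complex.ofReal_natCast, Complex.ofReal_ofNat, Nat.cast_one]
    ring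
  · simp

theorem rootWeight_B_one {r : ℕ} (hr : 2 ≤ r) (lam : Fin r → ℕ) (i : Fin r) :
    rootWeight (symmB r) i (weightsB lam 1) = if (i : ℕ) = 0 then 2 else 0 := by
  simp only [rootWeight, symmB, weightsB]
  split_ifs <;> first | (exfalso; omega) | simp_all

/-- The vanishing of `G` at `0` and beyond `r` supplies the missing neighbours of the end colours.
-/
theorem sum_rootRoot {r : ℕ} (i : Fin r) (G : ℕ → ℂ) (h0 : G 0 = 0) (hr : ∀ k, r < k → G k = 0) :
    ∑ j : Fin r, rootRoot (cartanB r) (symmB r) i j * G (j + 1) =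
      2 * ((if (i : ℕ) + 1 = r then 1 else 2) * G (i + 1) - G i - G (i + 2)) := by
  have hi := i.2
  simp only [rootRoot_B]
  rw [Fin.sum_univ_eq_sum_range (fun j => (if j = (i : ℕ) then (if (i : ℕ) + 1 = r then 2 else 4)
      else if j + 1 = (i : ℕ) ∨ (i : ℕ) + 1 = j then -2 else 0) * G (j + 1)) r]
  have : ∀ j ∈ Finset.range r, (if j = (i : ℕ) then (if (i : ℕ) + 1 = r then 2 else 4)
      else if j + 1 = (i : ℕ) ∨ (i : ℕ) + 1 = j then -2 else 0) * G (j + 1) =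
      (if j = (i : ℕ) then (if (i : ℕ) + 1 = r then 2 else 4) * G (i + 1) else 0) +
      (if j + 1 = (i : ℕ) then -2 * G i else 0) +
      (if (i : ℕ) + 1 = j then -2 * G (i + 2) else 0) := by
    intro j _
    by_cases h1 : j = (i : ℕ)
    · simp [h1]
    · by_cases h2 : j + 1 = (i : ℕ)
      · have : ¬ (i : ℕ) + 1 = j := by omega
        simp only [h1, h2, this]; simp
      · by_cases h3 : (i : ℕ) + 1 = j
        · have e : (i : ℕ) + 2 = j + 1 := by omega
          simp only [h1, h2, h3, e]; simp
        · simp [h1, h2, h3]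
  rw [Finset.sum_congr rfl this, Finset.sum_add_distrib, Finset.sum_add_distrib]
  have s1 : ∑ j ∈ Finset.range r, (if j = (i : ℕ) then
      (if (i : ℕ) + 1 = r then 2 else 4) * G (i + 1) else 0) =
      (if (i : ℕ) + 1 = r then 2 else 4) * G (i + 1) := by
    rw [Finset.sum_ite_eq' (Finset.range r) (i : ℕ), if_pos (Finset.mem_range.2 hi)]
  have s2 : ∑ j ∈ Finset.range r, (if j + 1 = (i : ℕ) then -2 * G i else 0) = -2 * G i := by
    rcases Nat.eq_zero_or_pos (i : ℕ) with h | h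
    · simp [h, h0]
    · rw [Finset.sum_eq_single ((i : ℕ) - 1)]
      · rw [if_pos (by omega)]
      · intro j _ hj; rw [if_neg (by omega)]
      · intro hj; exact absurd (Finset.mem_range.2 (by omega)) hj
  have s3 : ∑ j ∈ Finset.range r, (if (i : ℕ) + 1 = j then -2 * G (i + 2) else 0) =
      -2 * G (i + 2) := by
    by_cases h : (i : ℕ) + 1 < r
    · rw [Finset.sum_ite_eq (Finset.range r) ((i : ℕ) + 1), if_pos (Finset.mem_range.2 h)]
    · rw [hr (i + 2) (by omega)]; simp
  rw [s1, s2, s3]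
  split_ifs <;> ring

/-- The conditions on the variable number `i` of colour `k`. -/
def LocalSolution {r : ℕ} (lam : Fin r → ℕ) (L : ℕ) (a b : ℕ → ℂ) (k i : ℕ) : Prop :=
  (halvedLabel lam k ≠ 0 → rootOf a b k i ≠ 0) ∧
  (∀ m < colourCount r L k, m ≠ i → rootOf a b k i ≠ rootOf a b k m) ∧
  (∀ m < colourCount r L (k - 1), rootOf a b k i ≠ rootOf a b (k - 1) m) ∧
  (∀ m < colourCount r L (k + 1), rootOf a b k i ≠ rootOf a b (k + 1) m) ∧
  (halvedLabel lam k : ℂ) / rootOf a b k i + poleSum r L a b (k - 1) (rootOf a b k i) +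
    poleSum r L a b (k + 1) (rootOf a b k i) -
    (if k = r then 1 else 2) * poleSum r L a b k (rootOf a b k i) = 0

theorem sum_assemble {r : ℕ} (hr : 2 ≤ r) (lam : Fin r → ℕ) (L : ℕ) {a b : ℕ → ℂ} (h0 : a 0 = 1)
    (p : Σ i : Fin r, Fin (lengthTuple r L i)) :
    -(∑ s, rootWeight (symmB r) p.1 (weightsB lam s) / (assemble r L a b p - ![0, 1] s)) +
      ∑ q ∈ Finset.univ.erase p, rootRoot (cartanB r) (symmB r) p.1 q.1 /
        (assemble r L a b p - assemble r L a b q) =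
    -2 * ((halvedLabel lam (p.1 + 1) : ℂ) / assemble r L a b p +
      poleSum r L a b p.1 (assemble r L a b p) +
      poleSum r L a b (p.1 + 2) (assemble r L a b p) -
      (if (p.1 : ℕ) + 1 = r then 1 else 2) *
        poleSum r L a b (p.1 + 1) (assemble r L a b p)) := by
  have hp := p.1.2
  -- The term `q = p` has denominator zero, hence value `0`, and can be restored; `poleSum` at a
  -- variable of its own colour uses the same convention.
  rw [Finset.sum_erase _ (by simp), Fin.sum_univ_two, rootWeight_B_zero, rootWeight_B_one hr]
  generalize hx : assemble r L a b p = x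
  obtain ⟨G, hG⟩ : ∃ G : ℕ → ℂ, ∀ k, G k = if k = 0 then 0 else poleSum r L a b k x :=
    ⟨_, fun _ => rfl⟩
  have e1 : ∑ q : (Σ i : Fin r, Fin (lengthTuple r L i)),
      rootRoot (cartanB r) (symmB r) p.1 q.1 / (x - assemble r L a b q) =
      ∑ j : Fin r, rootRoot (cartanB r) (symmB r) p.1 j *
        G ((j : ℕ) + 1) := by
    rw [Fintype.sum_sigma]
    refine Finset.sum_congr rfl fun j _ => ?_
    simp only [hG, Nat.add_eq_zero_iff, one_ne_zero, and_false, if_false, poleSum, ← lengthTuple_eq,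
      Finset.mul_sum]
    rw [← Fin.sum_univ_eq_sum_range (fun m => rootRoot (cartanB r) (symmB r) p.1 j *
      (1 / (x - rootOf a b (j + 1) m)))]
    exact Finset.sum_congr rfl fun m _ => by rw [mul_one_div]; rfl
  rw [e1, sum_rootRoot p.1 G (by simp [hG])]
  · simp only [hG]
    simp only [Matrix.cons_val_zero, Matrix.cons_val_one, sub_zero, Nat.add_eq_zero_iff,
      one_ne_zero, OfNat.ofNat_ne_zero, and_false, if_false]
    rcases Nat.eq_zero_or_pos (p.1 : ℕ) with h | h
    · have : poleSum r L a b 0 x = 1 / (x - 1) := by simp [poleSum, colourCount, rootOf, h0]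
      rw [h, this]
      simp only [if_true]
      ring
    · simp only [h.ne', if_false, zero_div]
      ring
  · intro k hk
    have : k ≠ 0 := by omega
    simp [hG, this, poleSum, colourCount, hk]

/-- With `a 0 = 1`, the point `1` is the left neighbour of colour `1`, so that colour needs no
separate treatment. -/
theorem isSolutionB_iff {r : ℕ} (hr : 2 ≤ r) (lam : Fin r → ℕ) (L : ℕ) {a b : ℕ → ℂ}
    (h0 : a 0 = 1) : IsSolutionB lam L (assemble r L a b) ↔
      ∀ k, 1 ≤ k → k ≤ r → ∀ i < colourCount r L k, LocalSolution lam L a b k i := by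
  have ne : ∀ i j : Fin r, rootRoot (cartanB r) (symmB r) i j ≠ 0 ↔
      (j : ℕ) = i ∨ (j : ℕ) + 1 = i ∨ (i : ℕ) + 1 = j := by
    intro i j
    rw [rootRoot_B]
    split_ifs with h1 h2 h3 <;> simp [*]
  constructor
  · rintro ⟨c1, c2, c3⟩ k hk hkr i hi
    obtain ⟨j, rfl⟩ : ∃ j : Fin r, k = (j : ℕ) + 1 := ⟨⟨k - 1, by omega⟩, by simp; omega⟩
    have toFin : ∀ (j : Fin r) (m : ℕ), m < colourCount r L (j + 1) →
        ∃ q : Fin (lengthTuple r L j), (q : ℕ) = m := fun j m hm =>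
      ⟨⟨m, by rwa [lengthTuple_eq]⟩, rfl⟩
    obtain ⟨p, rfl⟩ := toFin j i hi
    refine ⟨fun h => ?_, fun m hm hmi => ?_, fun m hm => ?_, fun m hm => ?_, ?_⟩
    · refine c1 ⟨j, p⟩ 0 ?_
      rw [rootWeight_B_zero]
      exact mul_ne_zero two_ne_zero (by exact_mod_cast h)
    · obtain ⟨q, rfl⟩ := toFin j m hm
      refine c2 ⟨j, p⟩ ⟨j, q⟩ ?_ ((ne _ _).2 (.inl rfl))
      intro e
      simp only [Sigma.mk.injEq, heq_eq_eq, true_and] at e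
      exact hmi (by rw [e])
    · rw [Nat.add_sub_cancel] at hm ⊢
      rcases Nat.eq_zero_or_pos (j : ℕ) with h | h
      · have hm0 : m = 0 := by simpa [h, colourCount] using hm
        have := c1 ⟨j, p⟩ 1 (by rw [rootWeight_B_one hr]; simp [h])
        rw [hm0, h]
        simpa [assemble, h, rootOf, h0] using this
      · obtain ⟨i, hi⟩ : ∃ i : Fin r, (j : ℕ) = (i : ℕ) + 1 :=
          ⟨⟨j - 1, by omega⟩, by simp; omega⟩
        rw [hi] at hm
        obtain ⟨q, rfl⟩ := toFin i m hm
        have := c2 ⟨j, p⟩ ⟨i, q⟩ (fun e => by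
          have := congrArg (fun x => (x.1 : ℕ)) e
          simp only at this; omega) ((ne _ _).2 (.inr (.inl hi.symm)))
        simpa only [assemble, ← hi] using this
    · have hjr : (j : ℕ) + 1 < r := by
        by_contra hj
        simp [colourCount, show r < (j : ℕ) + 1 + 1 by omega] at hm
      obtain ⟨i, hi⟩ : ∃ i : Fin r, (j : ℕ) + 1 = i := ⟨⟨j + 1, hjr⟩, rfl⟩
      rw [hi] at hm
      obtain ⟨q, rfl⟩ := toFin i m hm
      have := c2 ⟨j, p⟩ ⟨i, q⟩ (fun e => by
          have := congrArg (fun x => (x.1 : ℕ)) e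
          simp only at this; omega) ((ne _ _).2 (.inr (.inr hi)))
      simpa only [assemble, ← hi] using this
    · have := c3 ⟨j, p⟩
      rw [sum_assemble hr lam L h0 ⟨j, p⟩] at this
      exact (mul_eq_zero.1 this).resolve_left (by norm_num)
  · intro h
    have loc : ∀ p : (Σ i : Fin r, Fin (lengthTuple r L i)),
        LocalSolution lam L a b ((p.1 : ℕ) + 1) p.2 := fun p =>
      h _ (by omega) (by have := p.1.2; omega) _ (by rw [← lengthTuple_eq]; exact p.2.2)
    refine ⟨fun p s => ?_, fun p q hpq hne => ?_, fun p => ?_⟩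
    · obtain ⟨l1, -, l3, -⟩ := loc p
      fin_cases s
      · intro hw
        refine l1 ?_
        rintro e
        apply hw
        show rootWeight (symmB r) p.1 (weightsB lam 0) = 0
        rw [rootWeight_B_zero, e]; simp
      · intro hw
        have hw : rootWeight (symmB r) p.1 (weightsB lam 1) ≠ 0 := hw
        rw [rootWeight_B_one hr] at hw
        have hp : (p.1 : ℕ) = 0 := by by_contra hp; simp [hp] at hw
        rw [hp] at l3
        have := l3 0 (by simp [colourCount])
        simpa [assemble, hp, rootOf, h0] using this
    · obtain ⟨-, l2, l3, l4, -⟩ := loc p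
      have hq : (q.2 : ℕ) < colourCount r L (q.1 + 1) := by rw [← lengthTuple_eq]; exact q.2.2
      rcases (ne _ _).1 hne with e | e | e
      · rw [e] at hq
        have := l2 _ hq (fun e' => hpq ?_)
        · simpa only [assemble, e] using this
        · obtain ⟨i, m⟩ := p
          obtain ⟨j, n⟩ := q
          obtain rfl : j = i := Fin.ext e
          simp only at e'
          obtain rfl : n = m := Fin.ext e'
          rfl
      · rw [Nat.add_sub_cancel, ← e] at l3
        simpa only [assemble, e] using l3 _ hq
      · have e' : (q.1 : ℕ) + 1 = (p.1 : ℕ) + 1 + 1 := by omega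
        rw [e'] at hq
        simpa only [assemble, e'] using l4 _ hq
    · rw [sum_assemble hr lam L h0 p]
      have := (loc p).2.2.2.2
      simp only [Nat.add_sub_cancel] at this
      unfold assemble
      rw [this, mul_zero]

theorem chain_weight_pos {n : ℕ} {w : ℕ → ℝ} {W : ℕ → ℂ} (hw : ∀ k, 0 ≤ w k)
    {x : ℝ} (hx : 0 < x) (hWn : W n = x)
    (hW : ∀ k, 1 ≤ k → k < n → W k = w k + W (k + 1) + 1) (k : ℕ) (h1 : 1 ≤ k) (hk : k ≤ n) :
    ∃ y : ℝ, 0 < y ∧ W k = y := by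
  induction hk using Nat.decreasingInduction with
  | self => exact ⟨x, hx, hWn⟩
  | of_succ k hk ih =>
    obtain ⟨y, hy, e⟩ := ih (by omega)
    refine ⟨w k + y + 1, by linarith [hw k], ?_⟩
    rw [hW k h1 hk, e]
    norm_cast

theorem eq_prod_of_step {n : ℕ} {c g : ℕ → ℂ} (h0 : c 0 = 1)
    (h : ∀ k, 1 ≤ k → k ≤ n → c k = c (k - 1) * g k) (k : ℕ) (hk : k ≤ n) :
    c k = ∏ i ∈ Finset.Icc 1 k, g i := by
  induction k with
  | zero => simp [h0]
  | succ k ih =>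
    rw [Finset.prod_Icc_succ_top (by omega), ← ih (by omega), h (k + 1) (by omega) hk,
      Nat.add_sub_cancel]

theorem sumLabels_eq_add {r : ℕ} (lam : Fin r → ℕ) {k n : ℕ} (h : k ≤ n) :
    sumLabels lam k n = label lam k + sumLabels lam (k + 1) n := by
  unfold sumLabels
  rw [← Finset.sum_Ioc_add_eq_sum_Icc h, add_comm]
  congr 1
  exact Finset.sum_congr (by ext; simp) fun _ _ => rfl

theorem sumLabels_succ {r : ℕ} (lam : Fin r → ℕ) {k n : ℕ} (h : k ≤ n + 1) :
    sumLabels lam k (n + 1) = sumLabels lam k n + label lam (n + 1) :=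
  Finset.sum_Icc_succ_top h _

theorem sumLabels_of_lt {r : ℕ} (lam : Fin r → ℕ) {k n : ℕ} (h : n < k) :
    sumLabels lam k n = 0 := by
  unfold sumLabels
  rw [Finset.Icc_eq_empty (by omega), Finset.sum_empty]

/-! ### Lengths `L ≤ r`. -/

section Low

variable {r : ℕ} {lam : Fin r → ℕ} {L : ℕ} {a b : ℕ → ℂ}

theorem colourCount_single {r L k : ℕ} (hk : k ≤ r) (h : k ≤ L) (h' : L ≤ r ∨ k ≤ 2 * r - L) :
    colourCount r L k = 1 := by
  unfold colourCount; split_ifs <;> omega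

theorem colourCount_low_zero {r L k : ℕ} (hL : L ≤ r) (h : L < k) : colourCount r L k = 0 := by
  unfold colourCount; split_ifs <;> omega

theorem colourCount_pair {r L k : ℕ} (hL : r < L) (h : 2 * r - L < k) (hk : k ≤ r) :
    colourCount r L k = 2 := by
  unfold colourCount; split_ifs <;> omega

theorem poleSum_single {r L k : ℕ} (h : colourCount r L k = 1) (x : ℂ) :
    poleSum r L a b k x = 1 / (x - a k) := by
  simp [poleSum, h, rootOf]

theorem poleSum_zero {r L k : ℕ} (h : colourCount r L k = 0) (x : ℂ) :
    poleSum r L a b k x = 0 := by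
  simp [poleSum, h]

theorem poleSum_pair {r L k : ℕ} (h : colourCount r L k = 2) (x : ℂ) :
    poleSum r L a b k x = pairPoles (a k) (b k) x := by
  simp [poleSum, h, rootOf, pairPoles, Finset.sum_range_succ]

theorem localSolution_low_iff (hL : L ≤ r) :
    (∀ k, 1 ≤ k → k ≤ r → ∀ i < colourCount r L k, LocalSolution lam L a b k i) ↔
    ∀ k, 1 ≤ k → k ≤ L → ((halvedLabel lam k : ℂ) ≠ 0 → a k ≠ 0) ∧ a k ≠ a (k - 1) ∧
      (halvedLabel lam k : ℂ) / a k + 1 / (a k - a (k - 1)) +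
        (if k < L then 1 / (a k - a (k + 1)) else 0) = 0 := by
  have c1 : ∀ k, k ≤ L → colourCount r L k = 1 := fun k hk =>
    colourCount_single (by omega) hk (.inl hL)
  have p1 : ∀ k, k ≤ L → ∀ x, poleSum r L a b k x = 1 / (x - a k) := fun k hk =>
    poleSum_single (c1 k hk)
  have right : ∀ k x, poleSum r L a b (k + 1) x = if k < L then 1 / (x - a (k + 1)) else 0 := by
    intro k x
    split_ifs with h
    · exact p1 _ h x
    · exact poleSum_zero (colourCount_low_zero hL (by omega)) x
  constructor
  · intro h k h1 hk
    obtain ⟨l1, -, l3, -, l5⟩ := h k h1 (by omega) 0 (by rw [c1 k hk]; exact one_pos)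
    rw [p1 _ (by omega), p1 _ hk, right] at l5
    rw [c1 _ (by omega)] at l3
    refine ⟨fun h => l1 (by exact_mod_cast h), l3 0 one_pos, ?_⟩
    simpa [rootOf] using l5
  · intro h k h1 hk i hi
    rcases le_or_gt k L with hkL | hkL
    · rw [c1 k hkL] at hi
      obtain rfl : i = 0 := by omega
      obtain ⟨l1, l2, l3⟩ := h k h1 hkL
      refine ⟨fun h => l1 (by exact_mod_cast h), fun m hm hm' => ?_, fun m hm => ?_,
        fun m hm => ?_, ?_⟩
      · rw [c1 k hkL] at hm; omega
      · rw [c1 _ (by omega)] at hm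
        obtain rfl : m = 0 := by omega
        exact l2
      · rcases lt_or_ge k L with hkL' | hkL'
        · rw [c1 _ hkL'] at hm
          obtain rfl : m = 0 := by omega
          have := (h (k + 1) (by omega) hkL').2.1
          simpa [rootOf] using this.symm
        · rw [colourCount_low_zero hL (by omega)] at hm
          omega
      · rw [p1 _ (by omega), p1 _ hkL, right]
        simpa [rootOf] using l3
    · rw [colourCount_low_zero hL hkL] at hi
      omega

/-- The partial sums that determine the solution for `L ≤ r`. -/
noncomputable def lowWeight {r : ℕ} (lam : Fin r → ℕ) (L i : ℕ) : ℂ :=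
  if L < r then sumLabels lam i L + L - i
  else sumLabels lam i (r - 1) + (label lam r : ℂ) / 2 + r - i

theorem lowWeight_last (hL : L ≤ r) : lowWeight lam L L = halvedLabel lam L := by
  unfold lowWeight halvedLabel
  rcases hL.lt_or_eq with h | h
  · rw [if_pos h, if_neg h.ne, sumLabels_eq_add _ le_rfl, sumLabels_of_lt _ (by omega)]
    simp
  · subst h
    rw [if_neg (lt_irrefl _), if_pos rfl]
    rcases Nat.eq_zero_or_pos L with h | h
    · subst h; simp [sumLabels, label]
    · rw [sumLabels_of_lt _ (by omega)]
      push_cast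
      ring

theorem lowWeight_step (hL : L ≤ r) (k : ℕ) (hk : k < L) :
    lowWeight lam L k = halvedLabel lam k + lowWeight lam L (k + 1) + 1 := by
  unfold lowWeight halvedLabel
  rw [if_neg (by omega : k ≠ r)]
  split_ifs with h
  · rw [sumLabels_eq_add _ hk.le]; push_cast; ring
  · rw [sumLabels_eq_add _ (by omega)]; push_cast; ring

theorem lowWeight_ne_zero (hL : L ≤ r) (h0 : 0 < L → 0 < halvedLabel lam L) (k : ℕ) (h1 : 1 ≤ k)
    (hk : k ≤ L) : lowWeight lam L k ≠ 0 ∧ lowWeight lam L k + 1 ≠ 0 := by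
  obtain ⟨y, hy, e⟩ := chain_weight_pos (halvedLabel_nonneg lam) (h0 (by omega))
    (lowWeight_last hL) (fun k _ => lowWeight_step hL k) k h1 hk
  rw [e]
  have : y + 1 ≠ 0 := by linarith
  exact ⟨by exact_mod_cast hy.ne', by exact_mod_cast this⟩

theorem low_iff (hr : 2 ≤ r) (hL : L ≤ r) (h0 : 0 < L → 0 < halvedLabel lam L) (ha : a 0 = 1) :
    IsSolutionB lam L (assemble r L a b) ↔
      ∀ k, 1 ≤ k → k ≤ L → a k = a (k - 1) * (lowWeight lam L k / (lowWeight lam L k + 1)) := by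
  rw [isSolutionB_iff hr lam L ha, localSolution_low_iff hL]
  exact chain_iff ha (lowWeight_last hL) (fun k _ => lowWeight_step hL k)
    (fun k h1 hk => (lowWeight_ne_zero hL h0 k h1 hk).1)
    (fun k h1 hk => (lowWeight_ne_zero hL h0 k h1 hk).2)

/-- With label zero the top equation would be `1 / (a L - a (L - 1)) = 0`. -/
theorem low_weight_pos (hr : 2 ≤ r) (hL : L ≤ r) (ha : a 0 = 1)
    (h : IsSolutionB lam L (assemble r L a b)) (h0 : 0 < L) : 0 < halvedLabel lam L := by
  rw [isSolutionB_iff hr lam L ha, localSolution_low_iff hL] at h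
  obtain ⟨-, h2, h3⟩ := h L h0 le_rfl
  refine lt_of_le_of_ne (halvedLabel_nonneg lam L) fun e => ?_
  rw [← e, if_neg (lt_irrefl _)] at h3
  have := sub_ne_zero.2 h2
  simp [this] at h3

theorem low_root (ha : a 0 = 1)
    (h : ∀ k, 1 ≤ k → k ≤ L → a k = a (k - 1) * (lowWeight lam L k / (lowWeight lam L k + 1)))
    (k : ℕ) (hk : k ≤ L) : a k = if L < r then rootLow lam L k else rootMid lam k := by
  rw [eq_prod_of_step ha h k hk]
  unfold lowWeight rootLow rootMid
  split_ifs with h <;> rfl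

theorem polyTuple_assemble (i : Fin r) : polyTuple (assemble r L a b) i =
    ∏ m ∈ Finset.range (colourCount r L (i + 1)),
      (Polynomial.X - Polynomial.C (rootOf a b (i + 1) m)) := by
  unfold polyTuple
  rw [← lengthTuple_eq, ← Fin.prod_univ_eq_prod_range
    (fun m => Polynomial.X - Polynomial.C (rootOf a b (i + 1) m))]
  rfl

theorem low_poly (hr : 2 ≤ r) (hL : L ≤ r) (ha : a 0 = 1)
    (h : IsSolutionB lam L (assemble r L a b)) (i : Fin r) :
    polyTuple (assemble r L a b) i = explicitPoly lam L (i + 1) := by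
  have h' := (low_iff hr hL (low_weight_pos hr hL ha h) ha).1 h
  rw [polyTuple_assemble, explicitPoly, if_pos hL]
  by_cases hi : (i : ℕ) + 1 ≤ L
  · rw [colourCount_single (by omega) hi (.inl hL), if_pos hi, ← low_root ha h' _ hi]
    simp only [Finset.range_one, Finset.prod_singleton, rootOf, if_true]
  · rw [if_neg hi, colourCount_low_zero hL (by omega)]
    simp

theorem low_exists (hr : 2 ≤ r) (hL : L ≤ r) (h0 : 0 < L → 0 < halvedLabel lam L) :
    ∃ t, IsSolutionB lam L t := by
  refine ⟨assemble r L (fun k => ∏ i ∈ Finset.Icc 1 k,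
    (lowWeight lam L i / (lowWeight lam L i + 1))) 0, (low_iff hr hL h0 (by simp)).2 ?_⟩
  intro k h1 _
  obtain ⟨k, rfl⟩ : ∃ j, k = j + 1 := ⟨k - 1, by omega⟩
  exact Finset.prod_Icc_succ_top (by omega) _

end Low

/-! ### Recovering the orbit from the polynomials. -/

/-- Tuples with the same polynomials differ by a permutation of the variables of the same colour. -/
theorem sameOrbit_of_polyTuple_eq {ι : Type*} {l : ι → ℕ} {t t' : (Σ i : ι, Fin (l i)) → ℂ}
    (h : ∀ i, polyTuple t i = polyTuple t' i) : SameOrbit t t' := by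
  classical
  have key : ∀ i, ∃ σ : Equiv.Perm (Fin (l i)), ∀ k, t' ⟨i, k⟩ = t ⟨i, σ k⟩ := by
    intro i
    have hm : (Finset.univ.val.map fun k : Fin (l i) => t ⟨i, k⟩) =
        Finset.univ.val.map fun k : Fin (l i) => t' ⟨i, k⟩ := by
      have := congrArg Polynomial.roots (h i)
      unfold polyTuple at this
      have e : ∀ f : Fin (l i) → ℂ, (∏ k, (Polynomial.X - Polynomial.C (f k))).roots =
          Finset.univ.val.map f := by
        intro f
        rw [← Polynomial.roots_multiset_prod_X_sub_C (Finset.univ.val.map f), Multiset.map_map]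
        rfl
      rwa [e fun k => t ⟨i, k⟩, e fun k => t' ⟨i, k⟩] at this
    -- Equal multisets of values have fibres of equal size; matching fibres gives the permutation.
    have fib : ∀ c : ℂ, Nonempty ({k : Fin (l i) // t' ⟨i, k⟩ = c} ≃ {k // t ⟨i, k⟩ = c}) := by
      intro c
      refine ⟨Fintype.equivOfCardEq ?_⟩
      have := congrArg (Multiset.count c) hm
      rw [Multiset.count_map, Multiset.count_map] at this
      rw [Fintype.card_subtype, Fintype.card_subtype]
      simp only [eq_comm (a := c)] at this
      exact this.symm
    exact ⟨Equiv.ofFiberEquiv fun c => (fib c).some,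
      fun k => (Equiv.ofFiberEquiv_map (fun c => (fib c).some) k).symm⟩
  choose σ hσ using key
  exact ⟨σ, hσ⟩

/-! ### Lengths `L > r`: splitting into a chain and a tail. -/

section High

variable {r : ℕ} {lam : Fin r → ℕ} {L : ℕ} {a b : ℕ → ℂ}

theorem localSolution_pair_iff {k : ℕ} (hc : colourCount r L k = 2) :
    (∀ i < colourCount r L k, LocalSolution lam L a b k i) ↔
    (halvedLabel lam k ≠ 0 → a k ≠ 0 ∧ b k ≠ 0) ∧ a k ≠ b k ∧
    (∀ m < colourCount r L (k - 1), a k ≠ rootOf a b (k - 1) m ∧ b k ≠ rootOf a b (k - 1) m) ∧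
    (∀ m < colourCount r L (k + 1), a k ≠ rootOf a b (k + 1) m ∧ b k ≠ rootOf a b (k + 1) m) ∧
    (halvedLabel lam k : ℂ) / a k + poleSum r L a b (k - 1) (a k) + poleSum r L a b (k + 1) (a k) -
      (if k = r then 1 else 2) / (a k - b k) = 0 ∧
    (halvedLabel lam k : ℂ) / b k + poleSum r L a b (k - 1) (b k) + poleSum r L a b (k + 1) (b k) -
      (if k = r then 1 else 2) / (b k - a k) = 0 := by
  have own_a : poleSum r L a b k (a k) = 1 / (a k - b k) := by
    simp [poleSum_pair hc, pairPoles]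
  have own_b : poleSum r L a b k (b k) = 1 / (b k - a k) := by
    simp [poleSum_pair hc, pairPoles]
  have ra : rootOf a b k 0 = a k := rfl
  have rb : rootOf a b k 1 = b k := rfl
  constructor
  · intro h
    obtain ⟨l1, l2, l3, l4, l5⟩ := h 0 (by omega)
    obtain ⟨m1, m2, m3, m4, m5⟩ := h 1 (by omega)
    rw [ra, own_a, mul_one_div] at l5
    rw [rb, own_b, mul_one_div] at m5
    exact ⟨fun h => ⟨l1 h, m1 h⟩, l2 1 (by omega) (by omega), fun m hm => ⟨l3 m hm, m3 m hm⟩,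
      fun m hm => ⟨l4 m hm, m4 m hm⟩, l5, m5⟩
  · rintro ⟨h1, h2, h3, h4, h5, h6⟩ i hi
    obtain rfl | rfl : i = 0 ∨ i = 1 := by omega
    · refine ⟨fun h => (h1 h).1, fun m hm hm' => ?_, fun m hm => (h3 m hm).1,
        fun m hm => (h4 m hm).1, ?_⟩
      · obtain rfl : m = 1 := by omega
        exact h2
      · rw [ra, own_a, mul_one_div]; exact h5
    · refine ⟨fun h => (h1 h).2, fun m hm hm' => ?_, fun m hm => (h3 m hm).2,
        fun m hm => (h4 m hm).2, ?_⟩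
      · obtain rfl : m = 0 := by omega
        exact h2.symm
      · rw [rb, own_b, mul_one_div]; exact h6

/-- Neighbouring colours each demand that their variables differ; `Tail` records this once, so half
of these conditions is redundant. -/
theorem tail_iff_localSolution (hL : r < L) (n k : ℕ) (hk : 2 * r - L < k) (hn : k + n = r) :
    (∀ j, k ≤ j → j ≤ r → ∀ i < colourCount r L j, LocalSolution lam L a b j i) ↔
    (∀ m < colourCount r L (k - 1), a k ≠ rootOf a b (k - 1) m ∧ b k ≠ rootOf a b (k - 1) m) ∧
    Tail (halvedLabel lam) a b n k (halvedLabel lam k) (poleSum r L a b (k - 1)) := by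
  have hck : colourCount r L k = 2 := colourCount_pair hL hk (by omega)
  induction n generalizing k with
  | zero =>
    have hk' : k = r := by omega
    have hc1 : colourCount r L (k + 1) = 0 := by simp [colourCount, show r < k + 1 by omega]
    have : (∀ j, k ≤ j → j ≤ r → ∀ i < colourCount r L j, LocalSolution lam L a b j i) ↔
        ∀ i < colourCount r L k, LocalSolution lam L a b k i :=
      ⟨fun h => h k le_rfl (by omega), fun h j h1 h2 => by
        obtain rfl : j = k := by omega
        exact h⟩
    rw [this, localSolution_pair_iff hck]
    simp only [poleSum_zero hc1, add_zero, if_pos hk', hc1, Tail]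
    constructor
    · rintro ⟨h1, h2, h3, -, h5, h6⟩
      exact ⟨h3, h2, h1, h5, h6⟩
    · rintro ⟨h3, h2, h1, h5, h6⟩
      exact ⟨h1, h2, h3, fun m hm => absurd hm (by omega), h5, h6⟩
  | succ n ih =>
    have hc1 : colourCount r L (k + 1) = 2 := colourCount_pair hL (by omega) (by omega)
    have hsplit : (∀ j, k ≤ j → j ≤ r → ∀ i < colourCount r L j, LocalSolution lam L a b j i) ↔
        (∀ i < colourCount r L k, LocalSolution lam L a b k i) ∧
        ∀ j, k + 1 ≤ j → j ≤ r → ∀ i < colourCount r L j, LocalSolution lam L a b j i :=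
      ⟨fun h => ⟨h k le_rfl (by omega), fun j hj => h j (by omega)⟩, fun h j h1 h2 => by
        rcases h1.lt_or_eq with h1 | rfl
        · exact h.2 j h1 h2
        · exact h.1⟩
    have hp1 : poleSum r L a b (k + 1) = pairPoles (a (k + 1)) (b (k + 1)) :=
      funext (poleSum_pair hc1)
    have hp : poleSum r L a b k = pairPoles (a k) (b k) := funext (poleSum_pair hck)
    refine (hsplit.trans (and_congr (localSolution_pair_iff hck)
      (ih (k + 1) (by omega) (by omega) hc1))).trans ?_
    simp only [Nat.add_sub_cancel, hp, hp1, if_neg (by omega : k ≠ r), Tail]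
    have ra : ∀ j, rootOf a b j 0 = a j := fun _ => rfl
    have rb : ∀ j, rootOf a b j 1 = b j := fun _ => rfl
    constructor
    · rintro ⟨⟨h1, h2, h3, h4, h5, h6⟩, -, h8⟩
      have g0 := h4 0 (by omega)
      have g1 := h4 1 (by omega)
      exact ⟨h3, h2, h1, ⟨g0.1, g1.1, g0.2, g1.2⟩, h5, h6, h8⟩
    · rintro ⟨h3, h2, h1, ⟨g1, g2, g3, g4⟩, h5, h6, h8⟩
      refine ⟨⟨h1, h2, h3, fun m hm => ?_, h5, h6⟩, fun m hm => ?_, h8⟩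
      · obtain rfl | rfl : m = 0 ∨ m = 1 := by omega
        · exact ⟨g1, g3⟩
        · exact ⟨g2, g4⟩
      · obtain rfl | rfl : m = 0 ∨ m = 1 := by omega
        · exact ⟨g1.symm, g2.symm⟩
        · exact ⟨g3.symm, g4.symm⟩

/-- With `m = 2r - L`, the tail sees the single variables only through `a m`, and they see the tail
only through the pair `m + 1`. -/
theorem localSolution_high_iff (hr : 0 < r) (hL : r < L) :
    (∀ k, 1 ≤ k → k ≤ r → ∀ i < colourCount r L k, LocalSolution lam L a b k i) ↔
    ((a (2 * r - L + 1) ≠ a (2 * r - L) ∧ b (2 * r - L + 1) ≠ a (2 * r - L)) ∧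
      Tail (halvedLabel lam) a b (r - (2 * r - L + 1)) (2 * r - L + 1)
        (halvedLabel lam (2 * r - L + 1)) fun x => 1 / (x - a (2 * r - L))) ∧
    ∀ k, 1 ≤ k → k ≤ 2 * r - L → ((halvedLabel lam k : ℂ) ≠ 0 → a k ≠ 0) ∧ a k ≠ a (k - 1) ∧
      (halvedLabel lam k : ℂ) / a k + 1 / (a k - a (k - 1)) +
        (if k < 2 * r - L then 1 / (a k - a (k + 1))
          else pairPoles (a (k + 1)) (b (k + 1)) (a k)) = 0 := by
  obtain ⟨m, hm⟩ : ∃ m, m = 2 * r - L := ⟨_, rfl⟩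
  rw [← hm]
  have hmr : m + 1 ≤ r := by omega
  have c1 : ∀ k, k ≤ m → colourCount r L k = 1 := fun k hk =>
    colourCount_single (by omega) (by omega) (.inr (by omega))
  have c2 : colourCount r L (m + 1) = 2 := colourCount_pair hL (by omega) hmr
  have p1 : ∀ k, k ≤ m → ∀ x, poleSum r L a b k x = 1 / (x - a k) := fun k hk =>
    poleSum_single (c1 k hk)
  have right : ∀ k, k ≤ m → ∀ x, poleSum r L a b (k + 1) x =
      if k < m then 1 / (x - a (k + 1)) else pairPoles (a (k + 1)) (b (k + 1)) x := by
    intro k hk x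
    split_ifs with h
    · exact p1 _ h x
    · obtain rfl : k = m := by omega
      exact poleSum_pair c2 x
  have hsplit : (∀ k, 1 ≤ k → k ≤ r → ∀ i < colourCount r L k, LocalSolution lam L a b k i) ↔
      (∀ j, m + 1 ≤ j → j ≤ r → ∀ i < colourCount r L j, LocalSolution lam L a b j i) ∧
      ∀ k, 1 ≤ k → k ≤ m → LocalSolution lam L a b k 0 := by
    constructor
    · exact fun h => ⟨fun j hj => h j (by omega), fun k h1 hk =>
        h k h1 (by omega) 0 (by rw [c1 k hk]; exact one_pos)⟩
    · intro h k h1 hk i hi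
      rcases le_or_gt k m with hkm | hkm
      · rw [c1 k hkm] at hi
        obtain rfl : i = 0 := by omega
        exact h.2 k h1 hkm
      · exact h.1 k hkm hk i hi
  rw [hsplit, tail_iff_localSolution hL (r - (m + 1)) (m + 1) (by omega) (by omega),
    Nat.add_sub_cancel, c1 m le_rfl, funext (p1 m le_rfl)]
  have ra : ∀ j, rootOf a b j 0 = a j := fun _ => rfl
  have hm1 : (∀ i < 1, a (m + 1) ≠ rootOf a b m i ∧ b (m + 1) ≠ rootOf a b m i) ↔
      a (m + 1) ≠ a m ∧ b (m + 1) ≠ a m := by simp [rootOf]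
  rw [hm1]
  refine and_congr_right fun hT => ?_
  constructor
  · intro h k h1 hk
    obtain ⟨l1, -, l3, -, l5⟩ := h k h1 hk
    rw [p1 _ (by omega), p1 _ hk, right _ hk] at l5
    rw [c1 _ (by omega)] at l3
    refine ⟨fun h => l1 (by exact_mod_cast h), l3 0 one_pos, ?_⟩
    simpa [rootOf] using l5
  · intro h k h1 hk
    obtain ⟨l1, l2, l3⟩ := h k h1 hk
    refine ⟨fun h => l1 (by exact_mod_cast h), fun i hi hi' => ?_, fun i hi => ?_,
      fun i hi => ?_, ?_⟩
    · rw [c1 k hk] at hi; omega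
    · rw [c1 _ (by omega)] at hi
      obtain rfl : i = 0 := by omega
      exact l2
    · rcases lt_or_ge k m with hkm | hkm
      · rw [c1 _ hkm] at hi
        obtain rfl : i = 0 := by omega
        have := (h (k + 1) (by omega) hkm).2.1
        simpa [rootOf] using this.symm
      · obtain rfl : k = m := by omega
        rw [c2] at hi
        obtain rfl | rfl : i = 0 ∨ i = 1 := by omega
        · exact hT.1.1.symm
        · exact hT.1.2.symm
    · rw [p1 _ (by omega), p1 _ hk, right _ hk]
      simpa [rootOf] using l3

end High

theorem Tail.congr_fun {w : ℕ → ℝ} {a b a' b' : ℕ → ℂ} {n k : ℕ} {μ : ℝ} {f : ℂ → ℂ}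
    (h : Tail w a b n k μ f) (ha : ∀ j, k ≤ j → a' j = a j) (hb : ∀ j, k ≤ j → b' j = b j) :
    Tail w a' b' n k μ f := by
  induction n generalizing k μ f with
  | zero => simpa only [Tail, ha k le_rfl, hb k le_rfl] using h
  | succ n ih =>
    have := ih h.2.2.2.2.2 (fun j hj => ha j (by omega)) (fun j hj => hb j (by omega))
    simp only [Tail, ha k le_rfl, hb k le_rfl, ha (k + 1) (by omega), hb (k + 1) (by omega)] at h ⊢
    exact ⟨h.1, h.2.1, h.2.2.1, h.2.2.2.1, h.2.2.2.2.1, this⟩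

theorem sumLabels_add {r : ℕ} (lam : Fin r → ℕ) {k j n : ℕ} (hk : k ≤ j + 1) (hj : j ≤ n) :
    sumLabels lam k j + sumLabels lam (j + 1) n = sumLabels lam k n := by
  induction n, hj using Nat.le_induction with
  | base => rw [sumLabels_of_lt lam (Nat.lt_succ_self j), add_zero]
  | succ n hn ih =>
    rw [sumLabels_succ lam (by omega), sumLabels_succ lam (by omega), ← ih, add_assoc]

/-! ### Lengths `L > r`: solutions. -/

section High

variable {r : ℕ} {lam : Fin r → ℕ} {L : ℕ} {a b : ℕ → ℂ}

/-- The labels that occur in the successive reflections, from the colour `m + 1` on. -/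
noncomputable def highWeight {r : ℕ} (lam : Fin r → ℕ) (m j : ℕ) : ℝ :=
  ∑ i ∈ Finset.Icc (m + 1) j, halvedLabel lam i + ((j : ℝ) - (m + 1))

theorem highWeight_first (m : ℕ) : highWeight lam m (m + 1) = halvedLabel lam (m + 1) := by
  simp [highWeight]

theorem highWeight_succ {m j : ℕ} (h : m ≤ j) :
    highWeight lam m (j + 1) = halvedLabel lam (j + 1) + highWeight lam m j + 1 := by
  unfold highWeight
  rw [Finset.sum_Icc_succ_top (by omega)]
  push_cast
  ring

theorem highWeight_eq {m j : ℕ} (h : j < r) :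
    (highWeight lam m j : ℂ) = sumLabels lam (m + 1) j + j - m - 1 := by
  unfold highWeight sumLabels
  have : ∑ i ∈ Finset.Icc (m + 1) j, halvedLabel lam i =
      ∑ i ∈ Finset.Icc (m + 1) j, (label lam i : ℝ) := by
    refine Finset.sum_congr rfl fun i hi => ?_
    have := (Finset.mem_Icc.1 hi).2
    rw [halvedLabel, if_neg (by omega)]
  rw [this]
  push_cast
  ring

theorem highWeight_last {m : ℕ} (h : m < r) :
    2 * (highWeight lam m r : ℂ) =
      2 * sumLabels lam (m + 1) (r - 1) + label lam r + 2 * r - 2 * m - 2 := by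
  obtain ⟨s, rfl⟩ : ∃ s, r = s + 1 := ⟨r - 1, by omega⟩
  rw [highWeight_succ (by omega)]
  push_cast
  rw [highWeight_eq (by omega), halvedLabel, if_pos rfl]
  push_cast
  ring

theorem topSum_eq (hL : r < L) (hL' : L ≤ 2 * r) :
    topSum lam L = 2 * (highWeight lam (2 * r - L) r : ℂ) + 2 := by
  rw [highWeight_last (by omega), topSum, Nat.cast_sub hL']
  push_cast
  ring

/-- The initial left neighbour is the last single variable, as `factorG` is empty at `m + 1`. The
factors of `G` are the successive ratios `(M - μ j - 1) / (M - μ j)`, those of `H` the `μ j / (μ j +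
1)`. -/
theorem tailData (hL : r < L) (hL' : L ≤ 2 * r) :
    TailData (halvedLabel lam) (2 * r - L + 1) r (highWeight lam (2 * r - L))
      (fun j => rootHigh lam L (2 * r - L) * factorG lam L j) (factorH lam L) := by
  have hLc : ((2 * r - L : ℕ) : ℂ) = 2 * r - L := by rw [Nat.cast_sub hL']; push_cast; rfl
  refine ⟨by omega, halvedLabel_nonneg lam, fun j hj _ => highWeight_succ (by omega),
    fun j hj hjr => ?_, by simp [factorH], fun j hj hjr => ?_⟩
  · have e : foldedSum lam (2 * r - L + 1) j + L - j - 2 =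
        2 * (highWeight lam (2 * r - L) r : ℂ) - highWeight lam (2 * r - L) j - 1 := by
      rw [highWeight_last (by omega), highWeight_eq hjr, foldedSum,
        ← sumLabels_add lam (by omega : 2 * r - L + 1 ≤ j + 1) (by omega : j ≤ r - 1), hLc]
      ring
    have e' : foldedSum lam (2 * r - L + 1) j + L - j - 1 =
        2 * (highWeight lam (2 * r - L) r : ℂ) - highWeight lam (2 * r - L) j := by
      linear_combination e
    simp only [factorG]
    rw [Finset.prod_Ico_succ_top hj, e, e', mul_assoc]
  · obtain ⟨d, hd⟩ : ∃ d, r = j + 1 + d := ⟨r - (j + 1), by omega⟩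
    have e1 : r - j = d + 1 := by omega
    have e2 : r - (j + 1) = d := by omega
    have e3 : r - (d + 1) = j := by omega
    have e4 : (r : ℂ) = j + 1 + d := by rw [hd]; push_cast; ring
    have e : sumLabels lam (2 * r - L + 1) j + L - r - (d + 1 : ℕ) - 1 =
        highWeight lam (2 * r - L) j := by
      rw [highWeight_eq hjr, hLc]
      push_cast
      linear_combination e4
    simp only [factorH]
    rw [e1, e2, Finset.prod_Icc_succ_top (by omega), e3, ← e]
    congr 2
    ring

/-- The partial sums that determine the single variables for `L > r`. -/
noncomputable def chainWeight {r : ℕ} (lam : Fin r → ℕ) (L k : ℕ) : ℂ :=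
  foldedSum lam k (2 * r - L) + L - k - 1

/-- The bracket is `M + 1`, the force of the tail on the last single variable. -/
theorem chainWeight_last (hL : r < L) (hL' : L ≤ 2 * r) :
    chainWeight lam L (2 * r - L) = (halvedLabel lam (2 * r - L) +
      (2 * highWeight lam (2 * r - L) r + 1) : ℝ) := by
  have hLc : ((2 * r - L : ℕ) : ℂ) = 2 * r - L := by rw [Nat.cast_sub hL']; push_cast; rfl
  push_cast
  rw [highWeight_last (by omega), chainWeight, foldedSum, sumLabels_eq_add lam le_rfl,
    sumLabels_of_lt lam (Nat.lt_succ_self _), halvedLabel, if_neg (by omega), hLc]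
  push_cast
  ring

theorem chainWeight_step (hL : r < L) (hL' : L ≤ 2 * r) (k : ℕ) (hk : k < 2 * r - L) :
    chainWeight lam L k = halvedLabel lam k + chainWeight lam L (k + 1) + 1 := by
  rw [chainWeight, chainWeight, foldedSum, foldedSum, sumLabels_eq_add lam hk.le, halvedLabel,
    if_neg (by omega)]
  push_cast
  ring

theorem highWeight_last_pos (hL : r < L) (hL' : L ≤ 2 * r)
    (h0 : 0 < halvedLabel lam (2 * r - L + 1)) : 0 < highWeight lam (2 * r - L) r :=
  (tailData hL hL').pos (by rwa [highWeight_first]) r (by omega) le_rfl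

theorem chainWeight_ne_zero (hL : r < L) (hL' : L ≤ 2 * r)
    (h0 : 0 < halvedLabel lam (2 * r - L + 1)) (k : ℕ) (h1 : 1 ≤ k)
    (hk : k ≤ 2 * r - L) : chainWeight lam L k ≠ 0 ∧ chainWeight lam L k + 1 ≠ 0 := by
  have hM := highWeight_last_pos hL hL' h0
  obtain ⟨y, hy, e⟩ := chain_weight_pos (halvedLabel_nonneg lam)
    (by linarith [halvedLabel_nonneg lam (2 * r - L)])
    (chainWeight_last hL hL') (fun k _ => chainWeight_step hL hL' k) k h1 hk
  rw [e]
  have : y + 1 ≠ 0 := by linarith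
  exact ⟨by exact_mod_cast hy.ne', by exact_mod_cast this⟩

theorem high_iff (hr : 2 ≤ r) (hL : r < L) (hL' : L ≤ 2 * r)
    (h0 : 0 < halvedLabel lam (2 * r - L + 1)) (ha : a 0 = 1) :
    IsSolutionB lam L (assemble r L a b) ↔
    ((a (2 * r - L + 1) ≠ a (2 * r - L) ∧ b (2 * r - L + 1) ≠ a (2 * r - L)) ∧
      Tail (halvedLabel lam) a b (r - (2 * r - L + 1)) (2 * r - L + 1)
        (halvedLabel lam (2 * r - L + 1)) fun x => 1 / (x - a (2 * r - L))) ∧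
    ∀ k, 1 ≤ k → k ≤ 2 * r - L →
      a k = a (k - 1) * (chainWeight lam L k / (chainWeight lam L k + 1)) := by
  have D := tailData (lam := lam) hL hL'
  rw [isSolutionB_iff hr lam L ha, localSolution_high_iff (by omega) hL]
  refine and_congr_right fun ⟨⟨na, nb⟩, hT⟩ => ?_
  have hu := hT.left_ne_zero (halvedLabel_nonneg lam) h0
  have hpp := hT.pairPoles_left na nb
  rw [← highWeight_first, D.tailTotal_eq _ _ le_rfl (by omega)] at hpp
  have hpp' : pairPoles (a (2 * r - L + 1)) (b (2 * r - L + 1)) (a (2 * r - L)) =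
      ((2 * highWeight lam (2 * r - L) r + 1 : ℝ) : ℂ) / a (2 * r - L) := by
    rw [eq_div_iff hu, mul_comm, hpp]
    push_cast
    rfl
  -- The label of the last single variable is replaced by one that includes the `M + 1` of the tail.
  rw [← chain_iff (n := 2 * r - L) (w := fun k => if k = 2 * r - L then chainWeight lam L k else
    halvedLabel lam k) ha (by simp)
    (fun k _ hk => by rw [if_neg hk.ne]; exact chainWeight_step hL hL' k hk)
    (fun k h1 hk => (chainWeight_ne_zero hL hL' h0 k h1 hk).1)
    (fun k h1 hk => (chainWeight_ne_zero hL hL' h0 k h1 hk).2)]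
  refine forall_congr' fun k => forall_congr' fun h1 => forall_congr' fun hk => ?_
  rcases hk.lt_or_eq with hk | hk
  · simp only [if_neg hk.ne, if_pos hk]
  · simp only [if_pos hk, if_neg (by omega : ¬ k < 2 * r - L)]
    rw [hk, hpp', chainWeight_last hL hL']
    simp only [hu, ne_eq, not_false_eq_true, implies_true, true_and]
    refine and_congr_right fun _ => ?_
    push_cast
    rw [add_div]
    constructor <;> intro h <;> linear_combination h

theorem high_root (ha : a 0 = 1)
    (h : ∀ k, 1 ≤ k → k ≤ 2 * r - L →
      a k = a (k - 1) * (chainWeight lam L k / (chainWeight lam L k + 1)))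
    (k : ℕ) (hk : k ≤ 2 * r - L) : a k = rootHigh lam L k := by
  rw [eq_prod_of_step ha h k hk]
  unfold chainWeight rootHigh
  exact Finset.prod_congr rfl fun i _ => by rw [sub_add_cancel]

theorem high_weight_pos (hr : 2 ≤ r) (hL : r < L) (ha : a 0 = 1)
    (h : IsSolutionB lam L (assemble r L a b)) : 0 < halvedLabel lam (2 * r - L + 1) := by
  rw [isSolutionB_iff hr lam L ha, localSolution_high_iff (by omega) hL] at h
  obtain ⟨⟨⟨na, nb⟩, hT⟩, -⟩ := h
  exact hT.weight_pos (halvedLabel_nonneg lam _) na nb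

theorem high_weight_ne_half (hr : 2 ≤ r) (hL : L = r + 1) (ha : a 0 = 1)
    (h : IsSolutionB lam L (assemble r L a b)) : halvedLabel lam r ≠ 1 / 2 := by
  intro e
  rw [isSolutionB_iff hr lam L ha, localSolution_high_iff (by omega) (by omega)] at h
  obtain ⟨⟨⟨na, nb⟩, hT⟩, -⟩ := h
  have h1 : 2 * r - L + 1 = r := by omega
  rw [h1] at hT na nb
  rw [e, Nat.sub_self] at hT
  exact hT.weight_ne_half na nb

theorem high_poly (hr : 2 ≤ r) (hL : r < L) (hL' : L ≤ 2 * r) (ha : a 0 = 1)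
    (h : IsSolutionB lam L (assemble r L a b)) (i : Fin r) :
    polyTuple (assemble r L a b) i = explicitPoly lam L (i + 1) := by
  have hi := i.2
  have h0 := high_weight_pos hr hL ha h
  have D := tailData (lam := lam) hL hL'
  obtain ⟨⟨⟨na, nb⟩, hT⟩, hc⟩ := (high_iff hr hL hL' h0 ha).1 h
  have hroot := high_root ha hc
  rw [polyTuple_assemble, explicitPoly, if_neg (by omega)]
  by_cases hk : (i : ℕ) + 1 ≤ 2 * r - L
  · rw [colourCount_single (by omega) (by omega) (.inr hk), if_pos hk, ← hroot _ hk]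
    simp only [Finset.range_one, Finset.prod_singleton, rootOf, if_true]
  · rw [colourCount_pair hL (by omega) (by omega), if_neg hk]
    have hu : rootHigh lam L (2 * r - L) * factorG lam L (2 * r - L + 1) = a (2 * r - L) := by
      rw [hroot _ le_rfl]; simp [factorG]
    obtain ⟨e1, e2⟩ := D.closed_form (a := a) (b := b) (by rwa [highWeight_first])
      (by rw [highWeight_first]; simpa only [hu] using hT) (by rwa [hu]) (by rwa [hu])
      (i + 1) (by omega) (by omega)
    have s : rootSum lam L (i + 1) = a (i + 1) + b (i + 1) := by
      rw [e1, rootSum, topSum_eq hL hL']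
      ring
    have p : rootProd lam L (i + 1) = a (i + 1) * b (i + 1) := by
      rw [e2, rootProd, topSum_eq hL hL']
      ring
    rw [s, p]
    simp only [Finset.prod_range_succ, Finset.prod_range_zero, rootOf, if_true, one_mul,
      one_ne_zero, if_false, Polynomial.C_add, Polynomial.C_mul]
    ring

theorem high_exists (hr : 2 ≤ r) (hL : r < L) (hL' : L ≤ 2 * r)
    (h0 : 0 < halvedLabel lam (2 * r - L + 1)) (h1 : L = r + 1 → 1 < 2 * halvedLabel lam r) :
    ∃ t, IsSolutionB lam L t := by
  have D := tailData (lam := lam) hL hL'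
  have hpos : 0 < highWeight lam (2 * r - L) (2 * r - L + 1) := by rwa [highWeight_first]
  -- With two or more colours of pairs this is automatic; with one it is the condition `1 < label
  -- lam r`.
  have hM : 1 < 2 * highWeight lam (2 * r - L) r := by
    rcases Nat.lt_or_ge (2 * r - L + 1) r with h | h
    · linarith [D.gap hpos _ le_rfl h]
    · have e : 2 * r - L + 1 = r := by omega
      have := highWeight_first (lam := lam) (2 * r - L)
      rw [e] at this
      rw [this]
      exact h1 (by omega)
  have hstep : ∀ k, 1 ≤ k → k ≤ 2 * r - L → rootHigh lam L k =
      rootHigh lam L (k - 1) * (chainWeight lam L k / (chainWeight lam L k + 1)) := by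
    intro k hk _
    obtain ⟨k, rfl⟩ : ∃ j, k = j + 1 := ⟨k - 1, by omega⟩
    rw [rootHigh, Finset.prod_Icc_succ_top (by omega), chainWeight, sub_add_cancel]
    rfl
  have hne : ∀ k, k ≤ 2 * r - L → rootHigh lam L k ≠ 0 := by
    intro k
    induction k with
    | zero => simp [rootHigh]
    | succ k ih =>
      intro hk
      rw [hstep _ (by omega) hk]
      obtain ⟨g1, g2⟩ := chainWeight_ne_zero hL hL' h0 (k + 1) (by omega) hk
      exact mul_ne_zero (ih (by omega)) (div_ne_zero g1 g2)
  have hu : rootHigh lam L (2 * r - L) * factorG lam L (2 * r - L + 1) =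
      rootHigh lam L (2 * r - L) := by simp [factorG]
  obtain ⟨a, b, na, nb, hT⟩ := D.exists_tail hpos hM (by rw [hu]; exact hne _ le_rfl)
  rw [hu] at na nb
  rw [highWeight_first] at hT
  simp only [hu] at hT
  refine ⟨assemble r L (fun k => if k ≤ 2 * r - L then rootHigh lam L k else a k) b,
    (high_iff hr hL hL' h0 (by simp [rootHigh])).2 ?_⟩
  have e : ¬ 2 * r - L + 1 ≤ 2 * r - L := by omega
  simp only [le_refl, if_true, if_neg e]
  refine ⟨⟨⟨na, nb⟩, hT.congr_fun (fun j hj => if_neg (by omega)) fun _ _ => rfl⟩, ?_⟩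
  intro k hk1 hk
  rw [if_pos hk, if_pos (by omega : k - 1 ≤ 2 * r - L)]
  exact hstep k hk1 hk

end High

/-! ### Admissibility and conclusion. -/

theorem halvedLabel_pos {r : ℕ} {lam : Fin r → ℕ} {k : ℕ} :
    0 < halvedLabel lam k ↔ 0 < label lam k := by
  unfold halvedLabel; split_ifs <;> simp

theorem IsSolutionB.admissible {r : ℕ} (hr : 2 ≤ r) {lam : Fin r → ℕ} {L : ℕ} (hL : L ≤ 2 * r)
    {t : (Σ i : Fin r, Fin (lengthTuple r L i)) → ℂ} (h : IsSolutionB lam L t) :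
    Admissible lam L := by
  obtain ⟨a, b, ha, rfl⟩ := exists_assemble t
  rcases Nat.eq_zero_or_pos L with h0 | h0
  · exact .inl h0
  rcases Nat.lt_or_ge r L with hL' | hL'
  · have hw := halvedLabel_pos.1 (high_weight_pos hr hL' ha h)
    rcases (show r + 1 ≤ L from hL').lt_or_eq with h1 | h1
    · exact .inr (.inr (.inr ⟨h1, hL, hw⟩))
    · refine .inr (.inr (.inl ⟨h1.symm, ?_⟩))
      have h2 := high_weight_ne_half hr h1.symm ha h
      rw [show 2 * r - L + 1 = r by omega] at hw
      have h3 : label lam r ≠ 1 := by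
        intro e
        apply h2
        rw [halvedLabel, if_pos rfl, e, Nat.cast_one]
      omega
  · exact .inr (.inl ⟨h0, hL', halvedLabel_pos.1 (low_weight_pos hr hL' ha h h0)⟩)

theorem IsSolutionB.polyTuple_eq {r : ℕ} (hr : 2 ≤ r) {lam : Fin r → ℕ} {L : ℕ} (hL : L ≤ 2 * r)
    {t : (Σ i : Fin r, Fin (lengthTuple r L i)) → ℂ} (h : IsSolutionB lam L t) (i : Fin r) :
    polyTuple t i = explicitPoly lam L (i + 1) := by
  obtain ⟨a, b, ha, rfl⟩ := exists_assemble t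
  rcases Nat.lt_or_ge r L with hL' | hL'
  · exact high_poly hr hL' hL ha h i
  · exact low_poly hr hL' ha h i

theorem Admissible.le {r : ℕ} {lam : Fin r → ℕ} {L : ℕ} (hr : 2 ≤ r) (h : Admissible lam L) :
    L ≤ 2 * r := by
  rcases h with h | h | h | h <;> omega

theorem Admissible.exists_solution {r : ℕ} {lam : Fin r → ℕ} {L : ℕ} (hr : 2 ≤ r)
    (h : Admissible lam L) : ∃ t, IsSolutionB lam L t := by
  rcases h with h | ⟨-, h2, h3⟩ | ⟨h1, h2⟩ | ⟨h1, h2, h3⟩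
  · exact low_exists hr (by omega) (by omega)
  · exact low_exists hr h2 fun _ => halvedLabel_pos.2 h3
  · have e : 2 * r - L + 1 = r := by omega
    refine high_exists hr (by omega) (by omega) (halvedLabel_pos.2 (by rw [e]; omega)) fun _ => ?_
    have : (1 : ℝ) < label lam r := by exact_mod_cast h2
    rw [halvedLabel, if_pos rfl]
    linarith
  · exact high_exists hr (by omega) h2 (halvedLabel_pos.2 h3) (by omega)

end BetheB

theorem mainTheorem2 (r : ℕ) (hr : 2 ≤ r) (lam : Fin r → ℕ) :
    (∀ L : ℕ, BetheB.Admissible lam L →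
      ∃ t : (Σ i : Fin r, Fin (BetheB.lengthTuple r L i)) → ℂ,
        BetheB.IsSolutionB lam L t ∧
        (∀ t' : (Σ i : Fin r, Fin (BetheB.lengthTuple r L i)) → ℂ,
          BetheB.IsSolutionB lam L t' → BetheB.SameOrbit t t') ∧
        ∀ i : Fin r, BetheB.polyTuple t i = BetheB.explicitPoly lam L ((i : ℕ) + 1)) ∧
    (∀ L : ℕ, L ≤ 2 * r → ¬ BetheB.Admissible lam L →
      ¬ ∃ t : (Σ i : Fin r, Fin (BetheB.lengthTuple r L i)) → ℂ,
        BetheB.IsSolutionB lam L t) := by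
  refine ⟨fun L hL => ?_, fun L hL hA ⟨t, ht⟩ => hA (ht.admissible hr hL)⟩
  obtain ⟨t, ht⟩ := hL.exists_solution hr
  refine ⟨t, ht, fun t' ht' => ?_, ht.polyTuple_eq hr (hL.le hr)⟩
  exact BetheB.sameOrbit_of_polyTuple_eq fun i =>
    (ht.polyTuple_eq hr (hL.le hr) i).trans (ht'.polyTuple_eq hr (hL.le hr) i).symm
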